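/- Let $X$ be a separable real Hilbert space and $Y=\mathbb{R}^J$. On a probability space let $(\epsilon,x)$ be a jointly Gaussian random variable in $Y\times X$, and let $\eta\sim\mathbb{Q}_0=\mathcal{N}(0,\mathcal{C}_\eta)$ be a Gaussian random variable in $Y$ with $\eta\perp x$ and $\eta\perp\epsilon$. Let $\mu_0=\mathcal{N}(\bar x,\mathcal{C}_x)$ denote the law of $x$ (the prior), let $\mathcal{G}_a:X\to Y$ be measurable, and let $y=\mathcal{G}_a(x)+\epsilon+\eta$. For $u\in X$ let $\tilde{\mathbb{Q}}_u$ be the conditional law of $y$ given $x=u$. Assume that for $\mu_0$-almost every $u$ one has $\tilde{\mathbb{Q}}_u\ll\mathbb{Q}_0$ and $$\frac{d\tilde{\mathbb{Q}}_u}{d\mathbb{Q}_0}(v)=\frac{1}{Z_0(v)}\exp(-\Phi(u;v))\quad\text{for }\mathbb{Q}_0\text{-a.e. }v,$$ where $Z_0:Y\to(0,\infty)$ is measurable and the potential $\Phi:X\times Y\to\mathbb{R}$ is $\mu_0\otimes\mathbb{Q}_0$-measurable and Lipschitz in its first argument on bounded sets: for every $r>0$ there is $K>0$ with $|\Phi(u_1;v)-\Phi(u_2;v)|\le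 K\|u_1-u_2\|_X$ whenever $\|u_1\|_X,\|u_2\|_X,|v|<r$. For $v\in Y$ let $\mu^v$ be the posterior measure $$\frac{d\mu^v}{d\mu_0}(u)=\frac{1}{Z(v)}\exp(-\Phi(u;v)),\qquad Z(v)=\int_X\exp(-\Phi(u;v))\,\mu_0(du).$$ Let $(E,\|\cdot\|_E)$ be the Cameron–Martin space of $\mu_0$. The Onsager–Machlup functional with data $v$ is $I_v(u)=\Phi(u;v)+\frac12\|u-\bar x\|_E^2$ if $u-\bar x\in E$, and $I_v(u)=+\infty$ otherwise. A point $\hat z\in X$ is a MAP estimator for a measure $\mu$ on $X$ if $$\lim_{\delta\downarrow0}\frac{\mu(B_\delta(\hat z))}{\sup_{u\in X}\mu(B_\delta(u))}=1 .$$ Then $\mu^v$ is the conditional law of $x$ given $y=v$ for almost every $v$ with respect to the law of $y$. Moreover, for every $v\in Y$ for which there is $M\in\mathbb{R}$ with $\Phi(u;v)\ge M$ for all $u\in X$: 1. every MAP estimator for $\mu^v$ minimises $I_v$ over $X$; 2. conversely, every minimiser $z^*$ of $I_v$ over $X$ lies in $\bar x+E$ and is a MAP estimator for $\mu^v$. 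-/

import Mathlib

open MeasureTheory ProbabilityTheory Filter Topology
open scoped ENNReal RealInnerProductSpace

noncomputable section

namespace BayesMAP

variable {X : Type*} [NormedAddCommGroup X] [InnerProductSpace ℝ X]
  [MeasurableSpace X] [BorelSpace X]

/-- The Cameron-Martin norm of `h` for a Gaussian measure `μ` on a Hilbert space, with value `∞`
off the Cameron-Martin space: the supremum of `⟪v, h⟫` over all `v` such that the linear
functional `⟪v, ·⟫` has variance at most one under `μ`, that is, `⟪C v, v⟫ ≤ 1` for the
covariance operator `C` of `μ`. -/
def cameronMartinNorm (μ : Measure X) (h : X) : ℝ≥0∞ :=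
  ⨆ (v : X) (_ : covarianceBilin μ v v ≤ 1), ENNReal.ofReal ⟪v, h⟫

/-- The Cameron-Martin space of a Gaussian measure, as a subset of the ambient space. -/
def cameronMartinSpace (μ : Measure X) : Set X := {h | cameronMartinNorm μ h ≠ ∞}

open Classical in
/-- The Onsager-Machlup functional for the prior `μ₀` and the potential `Φ` (at fixed data): it is
`Φ x + ‖x - x̄‖_E ^ 2 / 2` if `x - x̄` is in the Cameron-Martin space `E` of `μ₀`, where `x̄` is the
mean of `μ₀`, and `+∞` otherwise. -/
def onsagerMachlup (μ₀ : Measure X) (Φ : X → ℝ) (x : X) : EReal :=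
  if x - ∫ u, u ∂μ₀ ∈ cameronMartinSpace μ₀ then
    ((Φ x + 1 / 2 * (cameronMartinNorm μ₀ (x - ∫ u, u ∂μ₀)).toReal ^ 2 : ℝ) : EReal)
  else ⊤

/-- `z` is a maximum a posteriori (MAP) estimator for `μ`: the ratio of `μ (B_r(z))` to the supremum
of `μ (B_r(x))` over all centres `x` tends to one as the radius `r > 0` tends to zero. -/
def IsMAPEstimator (μ : Measure X) (z : X) : Prop :=
  Tendsto (fun r : ℝ => μ (Metric.ball z r) / ⨆ x : X, μ (Metric.ball x r)) (𝓝[>] 0) (𝓝 1)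

/-- The posterior measure for the prior `μ₀` and the potential `Φ` (at fixed data): its density with
respect to `μ₀` is `exp (-Φ x) / Z`, where `Z` is the integral of `exp (-Φ x)` under `μ₀`. -/
def posterior (μ₀ : Measure X) (Φ : X → ℝ) : Measure X :=
  μ₀.withDensity fun x => ENNReal.ofReal (Real.exp (-Φ x) / ∫ u, Real.exp (-Φ u) ∂μ₀)

end BayesMAP

end

/-! Centre the prior at its mean and write q(v) for the variance of `⟪v, ·⟫`. Legendre duality
identifies half the squared Cameron-Martin norm of h with the supremum over v of ⟪v, h⟫ - q(v)/2, so
the whole argument can use single vectors v of X. Two non-asymptotic bounds compare a ball of radius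
δ with the ball at the mean: `exp_mul_measure_ball_le` bounds its mass below by the factor
exp(-‖h‖_E²/2), and `measure_ball_le_exp_mul` bounds it above by exp(-(⟪v, u⟫ - q(v)/2) + δ‖v‖) for
every v. Both rest on the Cameron-Martin formula for shifts in the range of the covariance operator,
the lower one with symmetry of the Gaussian, the upper one with Anderson's inequality.

Since Φ is continuous in u, posterior masses of small balls therefore scale like exp(-I_v) times the
mass of the prior ball at the mean. Comparing two fixed centres shows that a MAP estimator minimises
I_v. The converse needs the upper bound uniformly over all centres. Centres violating it along radii
tending to zero satisfy a dual bound, because Φ is bounded below, and such a sequence is precompact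
(`exists_tendsto_subseq_of_inner_le`); at a limit point the local upper bound gives a contradiction.

The identification of the posterior is separate: the joint law of (x, y) has a density with respect
to a product measure, and disintegrating it in the other order cancels Z₀. -/

namespace BayesMAP

/-! ### The Cameron-Martin formula -/

section CameronMartin

variable {X : Type*} [NormedAddCommGroup X] [InnerProductSpace ℝ X] [CompleteSpace X]
  [SecondCountableTopology X] [MeasurableSpace X] [BorelSpace X]
  {γ : Measure X} [IsGaussian γ]

lemma covarianceBilin_of_centered (h0 : ∫ x, x ∂γ = 0) (a b : X) :
    covarianceBilin γ a b = ∫ x, ⟪a, x⟫ * ⟪b, x⟫ ∂γ := by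
  rw [covarianceBilin_apply IsGaussian.memLp_two_id]
  simp [h0]

lemma inner_covarianceOperator (h0 : ∫ x, x ∂γ = 0) (a b : X) :
    ⟪covarianceOperator γ a, b⟫ = covarianceBilin γ a b := by
  rw [covarianceOperator_inner IsGaussian.memLp_two_id, covarianceBilin_of_centered h0]

lemma map_inner_eq_gaussianReal (h0 : ∫ x, x ∂γ = 0) (a : X) :
    γ.map (fun x => ⟪a, x⟫) = gaussianReal 0 (covarianceBilin γ a a).toNNReal := by
  have h := (IsGaussian.hasGaussianLaw_id (μ := γ)).map_fun (innerSL ℝ a)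
  have h' := h.map_eq_gaussianReal
  simp only [id, innerSL_apply_apply] at h'
  rw [h', covarianceBilin_self IsGaussian.memLp_two_id, integral_inner, h0, inner_zero_right]
  exact IsGaussian.integrable_id

omit [CompleteSpace X] [SecondCountableTopology X] [IsGaussian γ] in
lemma covarianceBilin_sq_le (a b : X) :
    covarianceBilin γ a b ^ 2 ≤ covarianceBilin γ a a * covarianceBilin γ b b := by
  have h : ∀ t : ℝ, 0 ≤ covarianceBilin γ b b * (t * t) + (2 * covarianceBilin γ a b) * t
      + covarianceBilin γ a a := fun t => by
    have := covarianceBilin_self_nonneg (μ := γ) (a + t • b)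
    simp only [map_add, map_smul, add_apply, smul_apply,
      smul_eq_mul, covarianceBilin_comm b a] at this
    linarith
  have := discrim_le_zero h
  rw [discrim] at this
  linarith

lemma indepFun_inner_of_covarianceBilin_eq_zero {a b : X} (hab : covarianceBilin γ a b = 0) :
    IndepFun (fun x => ⟪a, x⟫) (fun x => ⟪b, x⟫) γ := by
  have h := (IsGaussian.hasGaussianLaw_id (μ := γ)).map_fun ((innerSL ℝ a).prod (innerSL ℝ b))
  simp only [id, ContinuousLinearMap.prod_apply, innerSL_apply_apply] at h
  refine h.indepFun_of_covariance_eq_zero ?_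
  rwa [← covarianceBilin_apply_eq_cov IsGaussian.memLp_two_id]

/-- Split t = a v + w with w uncorrelated to v. The pairings with v and w are then independent
Gaussians, and the integral factors into two one-dimensional moment generating functions at 1 + a i
and i. -/
lemma integral_cexp_inner_add (h0 : ∫ x, x ∂γ = 0) (v t : X) :
    ∫ x, Complex.exp ((⟪v, x⟫ : ℝ) + (⟪t, x⟫ : ℝ) * Complex.I) ∂γ =
      Complex.exp (((covarianceBilin γ v v - covarianceBilin γ t t) / 2 : ℝ)
        + (covarianceBilin γ v t : ℝ) * Complex.I) := by
  obtain ⟨a, ha⟩ : ∃ a : ℝ, covarianceBilin γ v t = a * covarianceBilin γ v v := by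
    -- If `⟪v, ·⟫` has variance zero, Cauchy-Schwarz makes its covariance with every functional
    -- vanish.
    by_cases hv : covarianceBilin γ v v = 0
    · refine ⟨0, ?_⟩
      have := covarianceBilin_sq_le (γ := γ) v t
      rw [hv, zero_mul] at this
      rw [zero_mul]
      exact pow_eq_zero_iff two_ne_zero |>.1 (le_antisymm this (sq_nonneg _))
    · exact ⟨covarianceBilin γ v t / covarianceBilin γ v v, by field_simp⟩
  have hw : covarianceBilin γ v (t - a • v) = 0 := by simp [ha]
  have hww : covarianceBilin γ (t - a • v) (t - a • v) =
      covarianceBilin γ t t - a ^ 2 * covarianceBilin γ v v := by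
    simp only [map_sub, map_smul, sub_apply, smul_apply,
      smul_eq_mul, covarianceBilin_comm t v, ha]
    ring
  have hind := indepFun_inner_of_covarianceBilin_eq_zero hw
  have e : ∀ x, Complex.exp ((⟪v, x⟫ : ℝ) + (⟪t, x⟫ : ℝ) * Complex.I) =
      Complex.exp ((1 + a * Complex.I) * (⟪v, x⟫ : ℝ)) *
        Complex.exp (Complex.I * (⟪t - a • v, x⟫ : ℝ)) := fun x => by
    rw [← Complex.exp_add]
    simp only [inner_sub_left, real_inner_smul_left]
    push_cast
    ring_nf
  simp_rw [e]
  have := hind.integral_fun_comp_mul_comp (by fun_prop) (by fun_prop)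
    (f := fun s : ℝ => Complex.exp ((1 + a * Complex.I) * (s : ℝ)))
    (g := fun s : ℝ => Complex.exp (Complex.I * (s : ℝ)))
    (Continuous.aestronglyMeasurable (by fun_prop)) (Continuous.aestronglyMeasurable (by fun_prop))
  rw [this]
  have h1 := complexMGF_gaussianReal (map_inner_eq_gaussianReal h0 v) (1 + a * Complex.I)
  have h2 := complexMGF_gaussianReal (map_inner_eq_gaussianReal h0 (t - a • v)) Complex.I
  simp only [complexMGF] at h1 h2
  rw [h1, h2, ← Complex.exp_add, Real.coe_toNNReal _ (covarianceBilin_self_nonneg _),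
    Real.coe_toNNReal _ (covarianceBilin_self_nonneg _), hww, ha]
  push_cast
  congr 1
  linear_combination (covarianceBilin γ t t : ℂ) / 2 * Complex.I_sq

lemma integrable_exp_inner_sub (h0 : ∫ x, x ∂γ = 0) (v : X) (c : ℝ) :
    Integrable (fun x => Real.exp (⟪v, x⟫ - c)) γ := by
  have h := integral_cexp_inner_add h0 v 0
  -- A Bochner integral that is not zero can only come from an integrable function.
  have hi := Integrable.of_integral_ne_zero (h ▸ Complex.exp_ne_zero _)
  refine (hi.norm.mul_const (Real.exp (-c))).congr (ae_of_all _ fun x => ?_)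
  simp [Complex.norm_exp, sub_eq_add_neg, Real.exp_add]

/-- The **Cameron–Martin formula**: the translate of a centered Gaussian measure by a vector in the
range of its covariance operator. -/
theorem map_add_covarianceOperator (h0 : ∫ x, x ∂γ = 0) (v : X) :
    γ.map (· + covarianceOperator γ v) =
      γ.withDensity fun x => ENNReal.ofReal (Real.exp (⟪v, x⟫ - covarianceBilin γ v v / 2)) := by
  have : IsFiniteMeasure (γ.withDensity fun x =>
      ENNReal.ofReal (Real.exp (⟪v, x⟫ - covarianceBilin γ v v / 2))) :=
    isFiniteMeasure_withDensity_ofReal (integrable_exp_inner_sub h0 v _).2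
  refine Measure.ext_of_charFun (funext fun t => ?_)
  rw [charFun_map_add_const, IsGaussian.charFun_eq', charFun_apply,
    integral_withDensity_eq_integral_toReal_smul (by fun_prop) (ae_of_all _ fun _ => by simp),
    inner_covarianceOperator h0]
  have e : ∀ x, (ENNReal.ofReal (Real.exp (⟪v, x⟫ - covarianceBilin γ v v / 2))).toReal •
      Complex.exp ((⟪x, t⟫ : ℝ) * Complex.I) =
      Complex.exp (-(covarianceBilin γ v v / 2 : ℝ)) *
        Complex.exp ((⟪v, x⟫ : ℝ) + (⟪t, x⟫ : ℝ) * Complex.I) := fun x => by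
    rw [ENNReal.toReal_ofReal (Real.exp_pos _).le, Complex.real_smul, Complex.ofReal_exp,
      ← Complex.exp_add, ← Complex.exp_add, real_inner_comm t x]
    push_cast
    ring_nf
  simp_rw [e]
  rw [integral_const_mul, integral_cexp_inner_add h0, ← Complex.exp_add, ← Complex.exp_add]
  simp only [id, h0, inner_zero_right]
  push_cast
  ring_nf

end CameronMartin

/-! ### Anderson's inequality for balls -/

section Anderson

/-- The interval and its translate have equal length, hence so do their two differences; the density
is at least its boundary value k on one difference and at most k on the other. Squared radii,
possibly negative, are the form in which slices of a ball appear. -/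
lemma gaussianReal_zero_sq_sub_le (s : NNReal) (c r : ℝ) :
    gaussianReal 0 s {t | (t - c) ^ 2 ≤ r} ≤ gaussianReal 0 s {t | t ^ 2 ≤ r} := by
  rcases lt_or_ge r 0 with hr | hr
  · have : {t : ℝ | (t - c) ^ 2 ≤ r} = ∅ := by
      ext t; simpa using hr.trans_le (sq_nonneg _)
    simp [this]
  by_cases hs : s = 0
  · subst hs
    rw [gaussianReal_zero_var, Measure.dirac_apply' (a := (0 : ℝ)) (s := {t | t ^ 2 ≤ r})
      (measurableSet_le (by fun_prop) (by fun_prop))]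
    simp [hr, Set.indicator_apply]
    split_ifs <;> simp
  set A : Set ℝ := {t | t ^ 2 ≤ r} with hA
  set B : Set ℝ := {t | (t - c) ^ 2 ≤ r} with hB
  have hAm : MeasurableSet A := measurableSet_le (by fun_prop) (by fun_prop)
  have hBm : MeasurableSet B := measurableSet_le (by fun_prop) (by fun_prop)
  have hvol : volume B = volume A := by
    have : B = (fun t => t - c) ⁻¹' A := rfl
    rw [this]
    exact (measurePreserving_sub_right volume c).measure_preimage hAm.nullMeasurableSet
  have hAfin : volume A ≠ ∞ := by
    have : A ⊆ Set.Icc (-√r) (√r) := fun t ht => by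
      exact abs_le.1 (Real.abs_le_sqrt ht)
    exact ((measure_mono this).trans_lt (by simp)).ne
  have hdiff : volume (B \ A) = volume (A \ B) := by
    have h1 := measure_inter_add_sdiff (μ := volume) A hBm
    have h2 := measure_inter_add_sdiff (μ := volume) B hAm
    rw [Set.inter_comm, hvol, ← h1] at h2
    exact (ENNReal.add_right_inj (ne_top_of_le_ne_top hAfin (measure_mono Set.inter_subset_left))).1 h2
  have hpdf : ∀ t, gaussianPDF 0 s t = ENNReal.ofReal ((√(2 * Real.pi * s))⁻¹ *
      Real.exp (-t ^ 2 / (2 * s))) := fun t => by simp [gaussianPDF, gaussianPDFReal]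
  set k : ℝ≥0∞ := ENNReal.ofReal ((√(2 * Real.pi * s))⁻¹ * Real.exp (-r / (2 * s))) with hk
  have hle : gaussianReal 0 s (B \ A) ≤ gaussianReal 0 s (A \ B) := by
    rw [gaussianReal_apply 0 hs, gaussianReal_apply 0 hs]
    calc ∫⁻ t in B \ A, gaussianPDF 0 s t ≤ ∫⁻ _ in B \ A, k := by
          refine setLIntegral_mono' (hBm.diff hAm) fun t ht => ?_
          rw [hpdf]
          have : r ≤ t ^ 2 := (not_le.1 ht.2).le
          exact ENNReal.ofReal_le_ofReal (mul_le_mul_of_nonneg_left (Real.exp_le_exp.2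
            (div_le_div_of_nonneg_right (neg_le_neg this) (by positivity))) (by positivity))
      _ = ∫⁻ _ in A \ B, k := by simp [hdiff]
      _ ≤ ∫⁻ t in A \ B, gaussianPDF 0 s t := by
          refine setLIntegral_mono' (hAm.diff hBm) fun t ht => ?_
          rw [hpdf]
          have : t ^ 2 ≤ r := ht.1
          exact ENNReal.ofReal_le_ofReal (mul_le_mul_of_nonneg_left (Real.exp_le_exp.2
            (div_le_div_of_nonneg_right (neg_le_neg this) (by positivity))) (by positivity))
  rw [← measure_inter_add_sdiff B hAm, ← measure_inter_add_sdiff A hBm, Set.inter_comm]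
  gcongr

variable {X : Type*} [NormedAddCommGroup X] [InnerProductSpace ℝ X] [CompleteSpace X]
  [SecondCountableTopology X] [MeasurableSpace X] [BorelSpace X]
  {γ : Measure X} [IsGaussian γ]

/-- For a principal direction e, the coordinate along e is independent of the orthogonal part.
Slicing the ball parallel to e reduces the claim to the one-dimensional inequality on each slice. -/
lemma measure_closedBall_le_sub_smul (h0 : ∫ x, x ∂γ = 0) {e : X} (he : ‖e‖ = 1)
    (hC : ∀ w, ⟪e, w⟫ = 0 → covarianceBilin γ e w = 0) (u : X) (δ : ℝ) :
    γ (Metric.closedBall u δ) ≤ γ (Metric.closedBall (u - ⟪e, u⟫ • e) δ) := by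
  set T : X →L[ℝ] X := ContinuousLinearMap.id ℝ X - (innerSL ℝ e).smulRight e with hT
  have hTa : ∀ x, T x = x - ⟪e, x⟫ • e := fun x => by simp [hT]
  have hee : ⟪e, e⟫ = 1 := by rw [real_inner_self_eq_norm_sq, he]; norm_num
  have heT : ∀ x, ⟪e, T x⟫ = 0 := fun x => by
    rw [hTa, inner_sub_right, real_inner_smul_right, hee]; ring
  have hind : IndepFun (fun x => ⟪e, x⟫) T γ := by
    have h := (IsGaussian.hasGaussianLaw_id (μ := γ)).map_fun ((innerSL ℝ e).prod T)
    simp only [id, ContinuousLinearMap.prod_apply, innerSL_apply_apply] at h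
    refine h.indepFun_of_covariance_inner fun a y => ?_
    have e1 : (fun x => ⟪a, ⟪e, x⟫⟫) = fun x => ⟪a • e, x⟫ := by
      ext x; simp [real_inner_smul_left, mul_comm]
    have e2 : (fun x => ⟪y, T x⟫) = fun x => ⟪T y, x⟫ := by
      ext x
      simp only [hTa, inner_sub_left, inner_sub_right, real_inner_smul_left, real_inner_smul_right,
        real_inner_comm e]
      ring
    rw [e1, e2, ← covarianceBilin_apply_eq_cov IsGaussian.memLp_two_id, map_smul, smul_apply,
      hC _ (heT y), smul_zero]
  have hmap := (indepFun_iff_map_prod_eq_prod_map_map (by fun_prop) (by fun_prop)).1 hind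
  rw [map_inner_eq_gaussianReal h0] at hmap
  -- `δ * |δ|` is δ² for nonnegative δ and negative otherwise, so the formula also covers the empty
  -- balls of negative radius.
  have hball : ∀ z : X, γ (Metric.closedBall z δ) = ∫⁻ w, gaussianReal 0
      (covarianceBilin γ e e).toNNReal {t | (t - ⟪e, z⟫) ^ 2 ≤ δ * |δ| - ‖w - T z‖ ^ 2}
        ∂(γ.map T) := fun z => by
    have hm : MeasurableSet {p : ℝ × X | (p.1 - ⟪e, z⟫) ^ 2 ≤ δ * |δ| - ‖p.2 - T z‖ ^ 2} :=
      measurableSet_le (by fun_prop) (by fun_prop)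
    have hpre : Metric.closedBall z δ = (fun x => (⟪e, x⟫, T x)) ⁻¹'
        {p : ℝ × X | (p.1 - ⟪e, z⟫) ^ 2 ≤ δ * |δ| - ‖p.2 - T z‖ ^ 2} := by
      ext x
      have key : ‖x - z‖ ^ 2 = (⟪e, x⟫ - ⟪e, z⟫) ^ 2 + ‖T x - T z‖ ^ 2 := by
        have h1 : x - z = (⟪e, x⟫ - ⟪e, z⟫) • e + (T x - T z) := by
          rw [hTa, hTa]; module
        rw [h1, norm_add_sq_real, norm_smul, he, real_inner_smul_left, inner_sub_right, heT, heT]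
        simp
      simp only [Metric.mem_closedBall, dist_eq_norm, Set.mem_preimage, Set.mem_ofPred_eq]
      rw [le_sub_iff_add_le, ← key]
      rcases le_or_gt 0 δ with hδ | hδ
      · rw [abs_of_nonneg hδ, ← sq, sq_le_sq₀ (norm_nonneg _) hδ]
      · rw [abs_of_neg hδ]
        constructor
        · intro h; linarith [norm_nonneg (x - z)]
        · intro h; nlinarith [sq_nonneg ‖x - z‖]
    rw [hpre, ← Measure.map_apply (by fun_prop) hm, hmap, Measure.prod_apply_symm hm]
    rfl
  rw [← hTa, hball, hball]
  refine lintegral_mono fun w => ?_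
  have hTT : T (T u) = T u := by rw [hTa (T u), heT, zero_smul, sub_zero]
  simp only [heT, hTT, sub_zero]
  exact gaussianReal_zero_sq_sub_le _ _ _

/-- An orthonormal eigenbasis of the covariance operator consists of principal directions, so the
coordinates of the centre can be removed one at a time. -/
lemma measure_closedBall_le_of_finiteDimensional [FiniteDimensional ℝ X] (h0 : ∫ x, x ∂γ = 0)
    (u : X) (δ : ℝ) : γ (Metric.closedBall u δ) ≤ γ (Metric.closedBall 0 δ) := by
  have hT := (isPositive_covarianceOperator (μ := γ)).isSymmetric
  set b := hT.eigenvectorBasis rfl with hb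
  have hC : ∀ i w, ⟪b i, w⟫ = 0 → covarianceBilin γ (b i) w = 0 := fun i w hw => by
    rw [← inner_covarianceOperator h0]
    have := hT.apply_eigenvectorBasis rfl i
    rw [← hb] at this
    erw [this]
    rw [real_inner_smul_left, hw, mul_zero]
  have key : ∀ s : Finset (Fin (Module.finrank ℝ X)), ∃ u', (∀ i ∈ s, ⟪b i, u'⟫ = 0) ∧
      γ (Metric.closedBall u δ) ≤ γ (Metric.closedBall u' δ) := fun s => by
    induction s using Finset.induction_on with
    | empty => exact ⟨u, by simp, le_rfl⟩
    | insert j s hj ih =>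
      obtain ⟨u', h1, h2⟩ := ih
      refine ⟨u' - ⟪b j, u'⟫ • b j, fun i hi => ?_, h2.trans
        (measure_closedBall_le_sub_smul h0 (b.norm_eq_one j) (hC j) u' δ)⟩
      rw [inner_sub_right, real_inner_smul_right]
      rcases eq_or_ne i j with rfl | hij
      · simp
      · rw [b.inner_eq_zero hij, h1 i (Finset.mem_of_mem_insert_of_ne hi hij)]; simp
  obtain ⟨u', h1, h2⟩ := key Finset.univ
  have : u' = 0 := by
    rw [← b.sum_repr' u']
    exact Finset.sum_eq_zero fun i hi => by rw [h1 i hi, zero_smul]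
  rwa [this] at h2

end Anderson

lemma exists_monotone_finiteDimensional_tendsto_starProjection (X : Type*) [NormedAddCommGroup X]
    [InnerProductSpace ℝ X] [SecondCountableTopology X] :
    ∃ V : ℕ → Submodule ℝ X, ∃ _ : ∀ n, FiniteDimensional ℝ (V n), Monotone V ∧
      ∀ x, Tendsto (fun n => (V n).starProjection x) atTop (𝓝 x) := by
  let V : ℕ → Submodule ℝ X := fun n =>
    Submodule.span ℝ (TopologicalSpace.denseSeq X '' (Set.Iio n))
  have hfin : ∀ n, FiniteDimensional ℝ (V n) := fun n =>
    FiniteDimensional.span_of_finite ℝ ((Set.finite_Iio n).image _)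
  have hmono : Monotone V := fun m n hmn =>
    Submodule.span_mono (Set.image_mono (Set.Iio_subset_Iio hmn))
  refine ⟨V, hfin, hmono, fun x => Submodule.starProjection_tendsto_self V hmono x ?_⟩
  have hsub : Set.range (TopologicalSpace.denseSeq X) ⊆ ((⨆ n, V n : Submodule ℝ X) : Set X) := by
    rintro _ ⟨n, rfl⟩
    exact (le_iSup V (n + 1)) (Submodule.subset_span ⟨n, Nat.lt_succ_self n, rfl⟩)
  intro y _
  rw [← SetLike.mem_coe, Submodule.topologicalClosure_coe]
  exact closure_mono hsub (TopologicalSpace.denseRange_denseSeq X y)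

/-- An open ball is an increasing union of closed ones. The slack r < s leaves room to replace the
centre w by a nearby point. -/
lemma mul_measure_ball_le_of_forall_closedBall {X : Type*} [PseudoMetricSpace X] [MeasurableSpace X]
    {μ : Measure X} {c : ℝ≥0∞} {u w : X} {δ : ℝ} (h : ∀ r s, r < s →
      c * μ (Metric.closedBall u r) ≤ μ (Metric.closedBall w s)) :
    c * μ (Metric.ball u δ) ≤ μ (Metric.ball w δ) := by
  have hU : Metric.ball u δ = ⋃ n : ℕ, Metric.closedBall u (δ - 1 / ((n : ℝ) + 1)) := by
    ext x
    simp only [Metric.mem_ball, Set.mem_iUnion, Metric.mem_closedBall]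
    constructor
    · intro hx
      obtain ⟨n, hn⟩ := exists_nat_one_div_lt (sub_pos.2 hx)
      exact ⟨n, by linarith⟩
    · rintro ⟨n, hn⟩
      have : (0 : ℝ) < 1 / ((n : ℝ) + 1) := Nat.one_div_pos_of_nat
      linarith
  have hm : Monotone fun n : ℕ => Metric.closedBall u (δ - 1 / ((n : ℝ) + 1)) := fun m n hmn =>
    Metric.closedBall_subset_closedBall (sub_le_sub_left (Nat.one_div_le_one_div hmn) _)
  rw [hU, hm.measure_iUnion, ENNReal.mul_iSup]
  have hpos (n : ℕ) : (0 : ℝ) < 1 / ((n : ℝ) + 1) := Nat.one_div_pos_of_nat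
  refine iSup_le fun n => (h _ (δ - 1 / ((n : ℝ) + 1) / 2) ?_).trans
    (measure_mono (Metric.closedBall_subset_ball ?_)) <;> linarith [hpos n]

section Anderson

variable {X : Type*} [NormedAddCommGroup X] [InnerProductSpace ℝ X] [CompleteSpace X]
  [SecondCountableTopology X] [MeasurableSpace X] [BorelSpace X]
  {γ : Measure X} [IsGaussian γ]

/-- **Anderson's inequality** for closed balls of a Hilbert space. -/
theorem measure_closedBall_le (h0 : ∫ x, x ∂γ = 0) (u : X) (δ : ℝ) :
    γ (Metric.closedBall u δ) ≤ γ (Metric.closedBall 0 δ) := by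
  obtain ⟨V, _, hmono, htend⟩ := exists_monotone_finiteDimensional_tendsto_starProjection X
  have hstep : ∀ n, γ (Metric.closedBall u δ) ≤ γ {x | ‖(V n).starProjection x‖ ≤ δ} := fun n => by
    set p : X →L[ℝ] V n := (V n).orthogonalProjectionOnto
    have hp0 : ∫ x, x ∂(γ.map p) = 0 := by
      rw [integral_map (by fun_prop) (by fun_prop),
        p.integral_comp_comm (φ := fun x => x) IsGaussian.integrable_id, h0, map_zero]
    calc γ (Metric.closedBall u δ) ≤ γ (p ⁻¹' Metric.closedBall (p u) δ) := by
          refine measure_mono fun x hx => ?_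
          rw [Set.mem_preimage, Metric.mem_closedBall, dist_eq_norm, ← map_sub]
          rw [Metric.mem_closedBall, dist_eq_norm] at hx
          exact ((V n).norm_orthogonalProjectionOnto_apply_le _).trans hx
      _ = γ.map p (Metric.closedBall (p u) δ) :=
          (Measure.map_apply (by fun_prop) Metric.isClosed_closedBall.measurableSet).symm
      _ ≤ γ.map p (Metric.closedBall 0 δ) := measure_closedBall_le_of_finiteDimensional hp0 _ _
      _ = γ {x | ‖(V n).starProjection x‖ ≤ δ} := by
          rw [Measure.map_apply (by fun_prop) Metric.isClosed_closedBall.measurableSet]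
          congr 1
          ext x
          simp [p]
  -- The cylinders over the growing subspaces decrease to the closed ball itself, so continuity from
  -- above passes the finite-dimensional bound to the limit.
  have hanti : Antitone fun n => {x | ‖(V n).starProjection x‖ ≤ δ} := fun m n hmn x hx => by
    have : (V m).starProjection x = (V m).starProjection ((V n).starProjection x) := by
      rw [Submodule.starProjection_apply (V m), Submodule.starProjection_apply (V m),
        Submodule.orthogonalProjectionOnto_starProjection_of_le (hmono hmn)]
    refine le_trans ?_ (show ‖(V n).starProjection x‖ ≤ δ from hx)
    rw [this]
    exact (V m).norm_starProjection_apply_le _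
  have hinter : ⋂ n, {x | ‖(V n).starProjection x‖ ≤ δ} ⊆ Metric.closedBall 0 δ := fun x hx => by
    rw [mem_closedBall_zero_iff]
    exact le_of_tendsto (htend x).norm (Eventually.of_forall fun n => Set.mem_iInter.1 hx n)
  have hlim := tendsto_measure_iInter_atTop (μ := γ)
    (s := fun n => {x | ‖(V n).starProjection x‖ ≤ δ})
    (fun n => (measurableSet_le (by fun_prop) (by fun_prop)).nullMeasurableSet) hanti
    ⟨0, measure_ne_top _ _⟩
  exact (ge_of_tendsto hlim (Eventually.of_forall hstep)).trans (measure_mono hinter)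

/-- **Anderson's inequality** for open balls of a Hilbert space. -/
theorem measure_ball_le (h0 : ∫ x, x ∂γ = 0) (u : X) (δ : ℝ) :
    γ (Metric.ball u δ) ≤ γ (Metric.ball 0 δ) := by
  simpa using mul_measure_ball_le_of_forall_closedBall (μ := γ) (c := 1) (u := u) (w := 0) (δ := δ)
    fun r s hrs => by
      simpa using (measure_closedBall_le h0 u r).trans
        (measure_mono (Metric.closedBall_subset_closedBall hrs.le))

end Anderson

/-! ### Two-sided Cameron-Martin bounds for balls -/

section SmallBalls

variable {X : Type*} [NormedAddCommGroup X] [InnerProductSpace ℝ X]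
  [MeasurableSpace X] [BorelSpace X] {γ : Measure X}

lemma inner_le_toReal_cameronMartinNorm {h : X} (hh : h ∈ cameronMartinSpace γ) {v : X}
    (hv : covarianceBilin γ v v ≤ 1) : ⟪v, h⟫ ≤ (cameronMartinNorm γ h).toReal :=
  (ENNReal.ofReal_le_iff_le_toReal hh).1
    (le_iSup₂ (f := fun (v : X) (_ : covarianceBilin γ v v ≤ 1) => ENNReal.ofReal ⟪v, h⟫) v hv)

lemma inner_le_toReal_cameronMartinNorm_mul_sqrt {h : X} (hh : h ∈ cameronMartinSpace γ) (v : X) :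
    ⟪v, h⟫ ≤ (cameronMartinNorm γ h).toReal * √(covarianceBilin γ v v) := by
  rcases (covarianceBilin_self_nonneg (μ := γ) v).eq_or_lt with hv | hv
  · rw [← hv, Real.sqrt_zero, mul_zero]
    by_contra! hpos
    -- Every multiple of a v of variance zero is admissible; this one pairs with h to the norm plus
    -- one.
    have := inner_le_toReal_cameronMartinNorm hh
      (v := (((cameronMartinNorm γ h).toReal + 1) / ⟪v, h⟫) • v) (by simp [← hv])
    rw [real_inner_smul_left, div_mul_cancel₀ _ hpos.ne'] at this
    linarith
  · have hs : 0 < √(covarianceBilin γ v v) := Real.sqrt_pos.2 hv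
    have := inner_le_toReal_cameronMartinNorm hh (v := (√(covarianceBilin γ v v))⁻¹ • v) (by
      simp only [map_smul, smul_apply, smul_eq_mul]
      rw [← mul_assoc, ← mul_inv, Real.mul_self_sqrt hv.le, inv_mul_cancel₀ hv.ne'])
    rwa [real_inner_smul_left, inv_mul_le_iff₀ hs, mul_comm] at this

/-- One half of Legendre duality: a bound on the concave dual functional yields both finiteness of
the norm and the bound on the energy. -/
lemma mem_cameronMartinSpace_of_forall_inner_le {h : X} {R : ℝ}
    (H : ∀ v, ⟪v, h⟫ - covarianceBilin γ v v / 2 ≤ R) :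
    h ∈ cameronMartinSpace γ ∧ 1 / 2 * (cameronMartinNorm γ h).toReal ^ 2 ≤ R := by
  have hR : 0 ≤ R := by simpa using H 0
  have key : cameronMartinNorm γ h ≤ ENNReal.ofReal √(2 * R) := by
    refine iSup₂_le fun v hv => ENNReal.ofReal_le_ofReal (Real.le_sqrt_of_sq_le ?_)
    -- With p = ⟪v, h⟫ and variance of v at most one, this multiple gives p² - p²/2 ≤ R.
    have := H (⟪v, h⟫ • v)
    simp only [real_inner_smul_left, map_smul, smul_apply, smul_eq_mul] at this
    nlinarith [sq_nonneg ⟪v, h⟫]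
  refine ⟨ne_top_of_le_ne_top ENNReal.ofReal_ne_top key, ?_⟩
  have h1 := ENNReal.toReal_mono ENNReal.ofReal_ne_top key
  rw [ENNReal.toReal_ofReal (Real.sqrt_nonneg _)] at h1
  have h2 := pow_le_pow_left₀ ENNReal.toReal_nonneg h1 2
  rw [Real.sq_sqrt (by positivity)] at h2
  linarith

variable [CompleteSpace X] [SecondCountableTopology X] [IsGaussian γ]

/-- A vector of the Cameron-Martin space is the limit of vectors in the range of the covariance
operator with no larger Cameron-Martin norm. -/
lemma mem_closure_covarianceOperator (h0 : ∫ x, x ∂γ = 0) {h : X}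
    (hh : h ∈ cameronMartinSpace γ) :
    h ∈ closure (covarianceOperator γ ''
      {v | covarianceBilin γ v v ≤ (cameronMartinNorm γ h).toReal ^ 2}) := by
  set r := (cameronMartinNorm γ h).toReal with hr
  have hr0 : 0 ≤ r := ENNReal.toReal_nonneg
  have hconv : Convex ℝ {v : X | covarianceBilin γ v v ≤ r ^ 2} := by
    intro v hv w hw a b ha hb hab
    have hvw : covarianceBilin γ v w ≤ r ^ 2 := by
      refine abs_le_of_sq_le_sq' (?_ : _ ≤ _) (sq_nonneg r) |>.2
      refine (covarianceBilin_sq_le v w).trans ?_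
      rw [sq (r ^ 2)]
      exact mul_le_mul hv hw (covarianceBilin_self_nonneg _) (sq_nonneg _)
    have e : covarianceBilin γ (a • v + b • w) (a • v + b • w) = a ^ 2 * covarianceBilin γ v v +
        2 * (a * b) * covarianceBilin γ v w + b ^ 2 * covarianceBilin γ w w := by
      simp only [map_add, map_smul, add_apply, smul_apply, smul_eq_mul, covarianceBilin_comm w v]
      ring
    have hv' : covarianceBilin γ v v ≤ r ^ 2 := hv
    have hw' : covarianceBilin γ w w ≤ r ^ 2 := hw
    change covarianceBilin γ (a • v + b • w) (a • v + b • w) ≤ r ^ 2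
    calc _ ≤ a ^ 2 * r ^ 2 + 2 * (a * b) * r ^ 2 + b ^ 2 * r ^ 2 := by rw [e]; gcongr
      _ = (a + b) ^ 2 * r ^ 2 := by ring
      _ = r ^ 2 := by rw [hab]; ring
  -- A functional w separating h from the closed convex image contradicts duality: on the image w
  -- comes up to r√q(w), attained at the multiple (r/√q(w)) w, while ⟪w, h⟫ is at most r√q(w).
  by_contra hnot
  obtain ⟨f, c, hf, hc⟩ := geometric_hahn_banach_closed_point
    (hconv.linear_image (covarianceOperator γ : X →ₗ[ℝ] X)).closure isClosed_closure hnot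
  set w := (InnerProductSpace.toDual ℝ X).symm f with hw
  have hfw : ∀ y, f y = ⟪w, y⟫ := fun y => by rw [hw, InnerProductSpace.toDual_symm_apply]
  have hC : ∀ v, covarianceBilin γ v v ≤ r ^ 2 → covarianceBilin γ v w < c := fun v hv => by
    have := hf _ (subset_closure ⟨v, hv, rfl⟩)
    rwa [hfw, real_inner_comm, ContinuousLinearMap.coe_coe, inner_covarianceOperator h0] at this
  have hcw := hc.trans_le ((hfw h).le.trans (inner_le_toReal_cameronMartinNorm_mul_sqrt hh w))
  rw [← hr] at hcw
  rcases (covarianceBilin_self_nonneg (μ := γ) w).eq_or_lt with h1 | h1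
  · have := hC 0 (by simpa using sq_nonneg r)
    rw [← h1] at hcw
    simp at this hcw
    linarith
  · have hs : 0 < √(covarianceBilin γ w w) := Real.sqrt_pos.2 h1
    have hsq := Real.mul_self_sqrt h1.le
    have := hC ((r / √(covarianceBilin γ w w)) • w) (by
      simp only [map_smul, smul_apply, smul_eq_mul]
      rw [← mul_assoc, div_mul_div_comm, hsq, div_mul_cancel₀ _ h1.ne', sq])
    simp only [map_smul, smul_apply, smul_eq_mul] at this
    have e : r / √(covarianceBilin γ w w) * covarianceBilin γ w w = r * √(covarianceBilin γ w w) := by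
      nth_rw 2 [← hsq]
      field_simp
    linarith

/-- A Cameron-Martin upper bound for the measure of small balls. -/
lemma measure_ball_le_exp_mul (h0 : ∫ x, x ∂γ = 0) (v u : X) (δ : ℝ) :
    γ (Metric.ball u δ) ≤ ENNReal.ofReal
      (Real.exp (-(⟪v, u⟫ - covarianceBilin γ v v / 2) + δ * ‖v‖)) * γ (Metric.ball 0 δ) := by
  -- Shifting the centre by -h turns the mass into an integral of the Cameron-Martin density over
  -- the ball at u - h. There ⟪v, x⟫ varies by at most δ‖v‖, and Anderson's inequality bounds the
  -- mass of the shifted ball.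
  set h := covarianceOperator γ v with hh
  have hcm := map_add_covarianceOperator (γ := γ) h0 (-v)
  have hpre : (· + covarianceOperator γ (-v)) ⁻¹' Metric.ball (u - h) δ = Metric.ball u δ := by
    ext x
    simp [dist_eq_norm, hh, sub_eq_add_neg]
  rw [← hpre, ← Measure.map_apply (by fun_prop) Metric.isOpen_ball.measurableSet, hcm,
    withDensity_apply _ Metric.isOpen_ball.measurableSet]
  calc _ ≤ ∫⁻ _ in Metric.ball (u - h) δ, ENNReal.ofReal
          (Real.exp (-(⟪v, u⟫ - covarianceBilin γ v v / 2) + δ * ‖v‖)) ∂γ := by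
        refine setLIntegral_mono' Metric.isOpen_ball.measurableSet fun x hx => ?_
        refine ENNReal.ofReal_le_ofReal (Real.exp_le_exp.2 ?_)
        have h1 : |⟪v, x - (u - h)⟫| ≤ ‖v‖ * δ := (abs_real_inner_le_norm _ _).trans
          (mul_le_mul_of_nonneg_left (mem_ball_iff_norm.1 hx).le (norm_nonneg _))
        have h2 : ⟪v, h⟫ = covarianceBilin γ v v := by
          rw [real_inner_comm, hh, inner_covarianceOperator h0]
        simp only [inner_sub_right, h2] at h1
        have h3 := (abs_le.1 h1).1
        simp only [inner_neg_left, map_neg, neg_apply, neg_neg]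
        linarith
    _ ≤ _ := by
        rw [setLIntegral_const]
        exact mul_le_mul_right (measure_ball_le h0 _ _) _

lemma map_neg_eq_self_of_centered (h0 : ∫ x, x ∂γ = 0) : γ.map (fun x => -x) = γ := by
  have : IsProbabilityMeasure (γ.map fun x => -x) := Measure.isProbabilityMeasure_map (by fun_prop)
  refine Measure.ext_of_charFun (funext fun t => ?_)
  rw [charFun_apply, integral_map (by fun_prop) (by fun_prop)]
  simp_rw [inner_neg_left, ← inner_neg_right]
  rw [← charFun_apply, IsGaussian.charFun_eq', IsGaussian.charFun_eq']
  simp [h0]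

lemma measure_closedBall_neg (h0 : ∫ x, x ∂γ = 0) (u : X) (δ : ℝ) :
    γ (Metric.closedBall (-u) δ) = γ (Metric.closedBall u δ) := by
  have h := Measure.map_apply (μ := γ) (f := fun x => -x) (by fun_prop)
    (Metric.isClosed_closedBall (x := -u) (ε := δ)).measurableSet
  rw [map_neg_eq_self_of_centered h0] at h
  rw [h]
  congr 1
  ext x
  simp

/-- By symmetry the balls at `C v` and `-C v` have equal mass. Averaging their Cameron-Martin
densities replaces the exponential of ⟪v, x⟫ by a hyperbolic cosine, which is at least one. -/
lemma exp_mul_measure_closedBall_le_covarianceOperator (h0 : ∫ x, x ∂γ = 0) (v : X) (δ : ℝ) :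
    ENNReal.ofReal (Real.exp (-(covarianceBilin γ v v / 2))) * γ (Metric.closedBall 0 δ) ≤
      γ (Metric.closedBall (covarianceOperator γ v) δ) := by
  have hBm : MeasurableSet (Metric.closedBall (0 : X) δ) := Metric.isClosed_closedBall.measurableSet
  have key : ∀ w, γ (Metric.closedBall (covarianceOperator γ w) δ) =
      ∫⁻ x in Metric.closedBall 0 δ,
        ENNReal.ofReal (Real.exp (-⟪w, x⟫ - covarianceBilin γ w w / 2)) ∂γ := fun w => by
    have hcm := map_add_covarianceOperator (γ := γ) h0 (-w)
    simp only [map_neg, neg_apply, neg_neg, inner_neg_left] at hcm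
    rw [← withDensity_apply _ hBm, ← hcm, Measure.map_apply (by fun_prop) hBm]
    congr 1
    ext x
    simp [dist_eq_norm, sub_eq_add_neg]
  have hsymm : γ (Metric.closedBall (covarianceOperator γ (-v)) δ) =
      γ (Metric.closedBall (covarianceOperator γ v) δ) := by
    rw [map_neg, measure_closedBall_neg h0]
  have h2 : 2 * (ENNReal.ofReal (Real.exp (-(covarianceBilin γ v v / 2))) *
      γ (Metric.closedBall 0 δ)) ≤ 2 * γ (Metric.closedBall (covarianceOperator γ v) δ) := by
    calc _ = ∫⁻ _ in Metric.closedBall (0 : X) δ,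
          2 * ENNReal.ofReal (Real.exp (-(covarianceBilin γ v v / 2))) ∂γ := by
          rw [setLIntegral_const, mul_assoc]
      _ ≤ ∫⁻ x in Metric.closedBall (0 : X) δ,
          (ENNReal.ofReal (Real.exp (-⟪v, x⟫ - covarianceBilin γ v v / 2)) +
          ENNReal.ofReal (Real.exp (-⟪-v, x⟫ - covarianceBilin γ (-v) (-v) / 2))) ∂γ := by
          refine lintegral_mono fun x => ?_
          rw [← ENNReal.ofReal_add (Real.exp_pos _).le (Real.exp_pos _).le,
            ← ENNReal.ofReal_ofNat, ← ENNReal.ofReal_mul (by norm_num)]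
          refine ENNReal.ofReal_le_ofReal ?_
          simp only [inner_neg_left, map_neg, neg_apply, neg_neg, sub_eq_add_neg, Real.exp_add]
          rw [← add_mul]
          refine mul_le_mul_of_nonneg_right ?_ (Real.exp_pos _).le
          linarith [Real.add_one_le_exp ⟪v, x⟫, Real.add_one_le_exp (-⟪v, x⟫)]
      _ = 2 * γ (Metric.closedBall (covarianceOperator γ v) δ) := by
          rw [lintegral_add_left (by fun_prop), ← key, ← key, hsymm, two_mul]
  exact (ENNReal.mul_le_mul_iff_right (by norm_num) (by norm_num)).1 h2

/-- A Cameron-Martin lower bound for the measure of balls. -/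
lemma exp_mul_measure_ball_le (h0 : ∫ x, x ∂γ = 0) {h : X} (hh : h ∈ cameronMartinSpace γ)
    (δ : ℝ) :
    ENNReal.ofReal (Real.exp (-(1 / 2 * (cameronMartinNorm γ h).toReal ^ 2))) *
      γ (Metric.ball 0 δ) ≤ γ (Metric.ball h δ) := by
  refine mul_measure_ball_le_of_forall_closedBall fun r s hrs => ?_
  obtain ⟨_, ⟨v, hv, rfl⟩, hdist⟩ := Metric.mem_closure_iff.1
    (mem_closure_covarianceOperator h0 hh) (s - r) (sub_pos.2 hrs)
  have hv' : covarianceBilin γ v v ≤ (cameronMartinNorm γ h).toReal ^ 2 := hv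
  calc _ ≤ ENNReal.ofReal (Real.exp (-(covarianceBilin γ v v / 2))) *
        γ (Metric.closedBall 0 r) := by
        gcongr ENNReal.ofReal (Real.exp ?_) * _
        linarith
    _ ≤ γ (Metric.closedBall (covarianceOperator γ v) r) :=
        exp_mul_measure_closedBall_le_covarianceOperator h0 v r
    _ ≤ γ (Metric.closedBall h s) := by
        refine measure_mono (Metric.closedBall_subset_closedBall' ?_)
        rw [dist_comm]
        linarith

/-- Were the central ball null, Anderson's inequality would make every ball of that radius null,
hence by separability the whole space. -/
lemma measure_ball_zero_pos (h0 : ∫ x, x ∂γ = 0) {δ : ℝ} (hδ : 0 < δ) :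
    0 < γ (Metric.ball 0 δ) := by
  rw [pos_iff_ne_zero]
  intro hz
  have h1 : ∀ u, γ (Metric.ball u δ) = 0 := fun u =>
    le_antisymm ((measure_ball_le h0 u δ).trans hz.le) zero_le
  have h2 : γ Set.univ = 0 := measure_null_of_locally_null _ fun x _ =>
    ⟨Metric.ball x δ, mem_nhdsWithin_of_mem_nhds (Metric.ball_mem_nhds x hδ), h1 x⟩
  simp at h2

end SmallBalls

/-! ### Compactness of almost admissible shifts -/

lemma totallyBounded_range_of_forall_isCompact {X : Type*} [PseudoMetricSpace X] {u : ℕ → X}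
    (h : ∀ ε > 0, ∃ K : Set X, IsCompact K ∧ ∀ᶠ n in atTop, ∃ k ∈ K, dist (u n) k < ε) :
    TotallyBounded (Set.range u) := by
  rw [Metric.totallyBounded_iff]
  intro ε hε
  obtain ⟨K, hK, hKu⟩ := h (ε / 2) (half_pos hε)
  obtain ⟨N, hN⟩ := eventually_atTop.1 hKu
  obtain ⟨t, ht, hcov⟩ := Metric.totallyBounded_iff.1 hK.totallyBounded (ε / 2) (half_pos hε)
  refine ⟨t ∪ u '' Set.Iio N, ht.union ((Set.finite_Iio N).image u), ?_⟩
  rintro _ ⟨n, rfl⟩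
  rcases lt_or_ge n N with hn | hn
  · exact Set.mem_iUnion₂.2 ⟨u n, Or.inr ⟨n, hn, rfl⟩, Metric.mem_ball_self hε⟩
  · obtain ⟨k, hk, hd⟩ := hN n hn
    obtain ⟨y, hy, hky⟩ := Set.mem_iUnion₂.1 (hcov hk)
    refine Set.mem_iUnion₂.2 ⟨y, Or.inl hy, ?_⟩
    rw [Metric.mem_ball] at hky ⊢
    linarith [dist_triangle (u n) k y]

section Compactness

variable {X : Type*} [NormedAddCommGroup X] [InnerProductSpace ℝ X] [CompleteSpace X]
  [SecondCountableTopology X] [MeasurableSpace X] [BorelSpace X]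
  {γ : Measure X} [IsGaussian γ]

lemma integrable_norm_sub_starProjection_sq (V : Submodule ℝ X) [FiniteDimensional ℝ V] :
    Integrable (fun x => ‖x - V.starProjection x‖ ^ 2) γ := by
  have h : MemLp (fun x => x - V.starProjection x) 2 γ :=
    (IsGaussian.memLp_two_id (μ := γ)).sub (IsGaussian.memLp_two_id.continuousLinearMap_comp _)
  exact h.integrable_norm_pow two_ne_zero

/-- The part of `u` orthogonal to `V` is controlled by the Cameron-Martin dual bound and the
residual second moment of `γ` off `V`. -/
lemma norm_sub_starProjection_le (h0 : ∫ x, x ∂γ = 0) (V : Submodule ℝ X) [FiniteDimensional ℝ V]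
    {u : X} {R δ : ℝ} (H : ∀ v, ⟪v, u⟫ ≤ R + covarianceBilin γ v v / 2 + δ * ‖v‖) {s : ℝ}
    (hs : 0 < s) (hδ : 0 ≤ δ) :
    ‖u - V.starProjection u‖ ≤ R / s + s * (∫ x, ‖x - V.starProjection x‖ ^ 2 ∂γ) / 2 + δ := by
  set z := u - V.starProjection u with hz
  have hR : 0 ≤ R := by simpa using H 0
  have hκ : 0 ≤ ∫ x, ‖x - V.starProjection x‖ ^ 2 ∂γ := integral_nonneg fun x => by positivity
  rcases eq_or_ne z 0 with h | h
  · rw [h, norm_zero]; positivity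
  have hzpos : 0 < ‖z‖ := norm_pos_iff.2 h
  set w := ‖z‖⁻¹ • z with hw
  have hw1 : ‖w‖ = 1 := by rw [hw, norm_smul, norm_inv, norm_norm, inv_mul_cancel₀ hzpos.ne']
  have hzV : z ∈ Vᗮ := V.sub_starProjection_mem_orthogonal u
  have hwV : ∀ x, ⟪w, V.starProjection x⟫ = 0 := fun x => by
    rw [real_inner_comm]
    exact Submodule.inner_right_of_mem_orthogonal (V.starProjection_apply_mem x)
      (Vᗮ.smul_mem _ hzV)
  have hwu : ⟪w, u⟫ = ‖z‖ := by
    have : ⟪w, u⟫ = ⟪w, z⟫ := by rw [hz, inner_sub_right, hwV, sub_zero]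
    rw [this, hw, real_inner_smul_left, real_inner_self_eq_norm_sq]
    field_simp
  have hC : covarianceBilin γ w w ≤ ∫ x, ‖x - V.starProjection x‖ ^ 2 ∂γ := by
    rw [covarianceBilin_of_centered h0]
    refine integral_mono_of_nonneg (ae_of_all _ fun x => mul_self_nonneg _)
      (integrable_norm_sub_starProjection_sq V) (ae_of_all _ fun x => ?_)
    have h1 : ⟪w, x⟫ = ⟪w, x - V.starProjection x⟫ := by rw [inner_sub_right, hwV, sub_zero]
    have h2 := abs_real_inner_le_norm w (x - V.starProjection x)
    rw [hw1, one_mul] at h2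
    simp only
    rw [h1, ← sq]
    exact sq_le_sq' (abs_le.1 h2).1 (abs_le.1 h2).2
  -- The unit vector w along the residual has variance at most the residual second moment. The free
  -- scale s trades R/s against s times that moment.
  have := H (s • w)
  rw [real_inner_smul_left, hwu, norm_smul, hw1, Real.norm_of_nonneg hs.le, mul_one] at this
  simp only [map_smul, smul_apply, smul_eq_mul] at this
  have h3 : s * ‖z‖ ≤ s * (R / s + s * (∫ x, ‖x - V.starProjection x‖ ^ 2 ∂γ) / 2 + δ) := by
    have e : s * (R / s + s * (∫ x, ‖x - V.starProjection x‖ ^ 2 ∂γ) / 2 + δ) =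
      R + s * (s * (∫ x, ‖x - V.starProjection x‖ ^ 2 ∂γ)) / 2 + δ * s := by field_simp
    rw [e]
    refine this.trans ?_
    gcongr
  exact le_of_mul_le_mul_left h3 hs

/-- A sequence of almost admissible shifts has a norm-convergent subsequence. -/
lemma exists_tendsto_subseq_of_inner_le (h0 : ∫ x, x ∂γ = 0) {u : ℕ → X} {δ : ℕ → ℝ} {R : ℝ}
    (hδ : ∀ n, 0 ≤ δ n) (hδ0 : Tendsto δ atTop (𝓝 0))
    (H : ∀ n v, ⟪v, u n⟫ ≤ R + covarianceBilin γ v v / 2 + δ n * ‖v‖) :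
    ∃ a, ∃ φ : ℕ → ℕ, StrictMono φ ∧ Tendsto (u ∘ φ) atTop (𝓝 a) := by
  suffices hT : TotallyBounded (Set.range u) by
    obtain ⟨a, -, φ, hφ, ha⟩ := (hT.closure.isCompact_of_isClosed isClosed_closure).tendsto_subseq
      (x := u) fun n => subset_closure ⟨n, rfl⟩
    exact ⟨a, φ, hφ, ha⟩
  have hR : 0 ≤ R := by simpa using H 0 0
  obtain ⟨D, hD⟩ := hδ0.bddAbove_range
  -- For the zero subspace the residual estimate bounds the full norm.
  obtain ⟨B, hB⟩ : ∃ B, ∀ n, ‖u n‖ ≤ B := by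
    refine ⟨R / 1 + 1 * (∫ x, ‖x - (⊥ : Submodule ℝ X).starProjection x‖ ^ 2 ∂γ) / 2 + D,
      fun n => ?_⟩
    have := norm_sub_starProjection_le h0 (⊥ : Submodule ℝ X) (H n) one_pos (hδ n)
    have h1 := hD ⟨n, rfl⟩
    have h2 : (⊥ : Submodule ℝ X).starProjection (u n) = 0 := by simp
    rw [h2, sub_zero] at this
    linarith
  obtain ⟨V, _, hmono, htend⟩ := exists_monotone_finiteDimensional_tendsto_starProjection X
  have hκ : Tendsto (fun n => ∫ x, ‖x - (V n).starProjection x‖ ^ 2 ∂γ) atTop (𝓝 0) := by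
    have := tendsto_integral_of_dominated_convergence (μ := γ)
      (F := fun n x => ‖x - (V n).starProjection x‖ ^ 2) (f := fun _ => (0 : ℝ))
      (fun x => ‖x - (⊥ : Submodule ℝ X).starProjection x‖ ^ 2)
      (fun n => Continuous.aestronglyMeasurable (by fun_prop))
      (integrable_norm_sub_starProjection_sq _) (fun n => ae_of_all _ fun x => ?_)
      (ae_of_all _ fun x => ?_)
    · simpa using this
    · have h1 := (V n).norm_sq_eq_add_norm_sq_starProjection x
      have h2 : (⊥ : Submodule ℝ X).starProjection x = 0 := by simp
      rw [h2, sub_zero, Real.norm_of_nonneg (by positivity)]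
      rw [Submodule.starProjection_orthogonal_val] at h1
      nlinarith [sq_nonneg ‖(V n).starProjection x‖]
    · have := ((tendsto_const_nhds (x := x)).sub (htend x)).norm.pow 2
      simpa using this
  refine totallyBounded_range_of_forall_isCompact fun ε hε => ?_
  -- This scale gives R/s < ε/4, and the added 1 keeps it positive when R = 0. Then N makes the
  -- moment term less than ε/4, and late n do the same for δ.
  set s : ℝ := (4 * R + 1) / ε with hs
  have hspos : 0 < s := by positivity
  obtain ⟨N, hN⟩ := (hκ.eventually (gt_mem_nhds (show 0 < ε / (2 * s) by positivity))).exists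
  refine ⟨(V N).subtypeL '' Metric.closedBall 0 B,
    (isCompact_closedBall _ _).image (V N).subtypeL.continuous, ?_⟩
  filter_upwards [hδ0.eventually (gt_mem_nhds (show 0 < ε / 4 by positivity))] with n hn
  refine ⟨(V N).starProjection (u n), ⟨(V N).orthogonalProjectionOnto (u n), ?_, rfl⟩, ?_⟩
  · rw [mem_closedBall_zero_iff]
    exact ((V N).norm_orthogonalProjectionOnto_apply_le _).trans (hB n)
  · rw [dist_eq_norm]
    have h1 := norm_sub_starProjection_le h0 (V N) (H n) hspos (hδ n)
    have h2 : R / s < ε / 4 := by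
      rw [hs, div_div_eq_mul_div, div_lt_div_iff₀ (by positivity) (by norm_num)]
      nlinarith
    have h3 : s * (∫ x, ‖x - (V N).starProjection x‖ ^ 2 ∂γ) < ε / 2 := by
      have := mul_lt_mul_of_pos_left hN hspos
      have e : s * (ε / (2 * s)) = ε / 2 := by field_simp
      linarith
    linarith

end Compactness

/-! ### Transfer to Gaussians with arbitrary mean -/

section Translation

variable {X : Type*} [NormedAddCommGroup X] [InnerProductSpace ℝ X] [CompleteSpace X]
  [SecondCountableTopology X] [MeasurableSpace X] [BorelSpace X]
  (μ : Measure X) [IsGaussian μ]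

omit [SecondCountableTopology X] in
lemma covarianceBilin_map_sub_mean :
    covarianceBilin (μ.map fun x => x - ∫ u, u ∂μ) = covarianceBilin μ := by
  simp_rw [sub_eq_neg_add]
  exact covarianceBilin_map_const_add _

lemma integral_map_sub_mean : ∫ x, x ∂(μ.map fun x => x - ∫ u, u ∂μ) = 0 := by
  rw [integral_map (by fun_prop) (by fun_prop), integral_sub (f := fun x => x)
    IsGaussian.integrable_id (integrable_const _)]
  simp

omit [SecondCountableTopology X] in
lemma cameronMartinNorm_map_sub_mean :
    cameronMartinNorm (μ.map fun x => x - ∫ u, u ∂μ) = cameronMartinNorm μ := by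
  ext h
  simp only [cameronMartinNorm, covarianceBilin_map_sub_mean]

omit [CompleteSpace X] [SecondCountableTopology X] [IsGaussian μ] in
lemma map_sub_mean_ball (z : X) (δ : ℝ) :
    (μ.map fun x => x - ∫ u, u ∂μ) (Metric.ball (z - ∫ u, u ∂μ) δ) = μ (Metric.ball z δ) := by
  rw [Measure.map_apply (by fun_prop) Metric.isOpen_ball.measurableSet]
  congr 1
  ext x
  simp

omit [CompleteSpace X] [SecondCountableTopology X] [IsGaussian μ] in
lemma map_sub_mean_ball_zero (δ : ℝ) :
    (μ.map fun x => x - ∫ u, u ∂μ) (Metric.ball 0 δ) = μ (Metric.ball (∫ u, u ∂μ) δ) := by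
  rw [← map_sub_mean_ball μ, sub_self]

lemma measure_ball_le_exp_mul_mean (v u : X) (δ : ℝ) :
    μ (Metric.ball u δ) ≤ ENNReal.ofReal
      (Real.exp (-(⟪v, u - ∫ u, u ∂μ⟫ - covarianceBilin μ v v / 2) + δ * ‖v‖)) *
        μ (Metric.ball (∫ u, u ∂μ) δ) := by
  rw [← map_sub_mean_ball μ, ← map_sub_mean_ball_zero μ, ← covarianceBilin_map_sub_mean μ]
  exact measure_ball_le_exp_mul (integral_map_sub_mean μ) v _ δ

lemma exp_mul_measure_ball_mean_le {h : X} (hh : h - ∫ u, u ∂μ ∈ cameronMartinSpace μ) (δ : ℝ) :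
    ENNReal.ofReal (Real.exp (-(1 / 2 * (cameronMartinNorm μ (h - ∫ u, u ∂μ)).toReal ^ 2))) *
      μ (Metric.ball (∫ u, u ∂μ) δ) ≤ μ (Metric.ball h δ) := by
  rw [← map_sub_mean_ball_zero μ, ← map_sub_mean_ball μ h, ← cameronMartinNorm_map_sub_mean μ]
  refine exp_mul_measure_ball_le (integral_map_sub_mean μ) ?_ δ
  rwa [cameronMartinSpace, cameronMartinNorm_map_sub_mean μ]

lemma measure_ball_mean_pos {δ : ℝ} (hδ : 0 < δ) : 0 < μ (Metric.ball (∫ u, u ∂μ) δ) := by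
  rw [← map_sub_mean_ball_zero μ]
  exact measure_ball_zero_pos (integral_map_sub_mean μ) hδ

variable {μ} in
lemma exists_tendsto_subseq_of_inner_sub_mean_le {u : ℕ → X} {δ : ℕ → ℝ} {R : ℝ}
    (hδ : ∀ n, 0 ≤ δ n) (hδ0 : Tendsto δ atTop (𝓝 0))
    (H : ∀ n v, ⟪v, u n - ∫ u, u ∂μ⟫ ≤ R + covarianceBilin μ v v / 2 + δ n * ‖v‖) :
    ∃ a, ∃ φ : ℕ → ℕ, StrictMono φ ∧ Tendsto (u ∘ φ) atTop (𝓝 a) := by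
  rw [← covarianceBilin_map_sub_mean μ] at H
  obtain ⟨a, φ, hφ, ha⟩ :=
    exists_tendsto_subseq_of_inner_le (integral_map_sub_mean μ) hδ hδ0 H
  exact ⟨a + ∫ u, u ∂μ, φ, hφ, (ha.add_const (∫ u, u ∂μ)).congr fun n => by simp⟩

end Translation

/-! ### Small balls under an exponentially tilted Gaussian -/

section Tilted

variable {X : Type*} [NormedAddCommGroup X] [InnerProductSpace ℝ X] [CompleteSpace X]
  [SecondCountableTopology X] [MeasurableSpace X] [BorelSpace X]
  {μ : Measure X} [IsGaussian μ] {Ψ : X → ℝ}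

omit [CompleteSpace X] [SecondCountableTopology X] [IsGaussian μ] [InnerProductSpace ℝ X] in
lemma withDensity_exp_neg_ball_le {u : X} {δ c : ℝ} (h : ∀ x ∈ Metric.ball u δ, c ≤ Ψ x) :
    μ.withDensity (fun x => ENNReal.ofReal (Real.exp (-Ψ x))) (Metric.ball u δ) ≤
      ENNReal.ofReal (Real.exp (-c)) * μ (Metric.ball u δ) := by
  rw [withDensity_apply _ Metric.isOpen_ball.measurableSet, ← setLIntegral_const]
  exact setLIntegral_mono' Metric.isOpen_ball.measurableSet fun x hx =>
    ENNReal.ofReal_le_ofReal (Real.exp_le_exp.2 (neg_le_neg (h x hx)))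

omit [CompleteSpace X] [SecondCountableTopology X] [IsGaussian μ] [InnerProductSpace ℝ X] in
lemma le_withDensity_exp_neg_ball {u : X} {δ c : ℝ} (h : ∀ x ∈ Metric.ball u δ, Ψ x ≤ c) :
    ENNReal.ofReal (Real.exp (-c)) * μ (Metric.ball u δ) ≤
      μ.withDensity (fun x => ENNReal.ofReal (Real.exp (-Ψ x))) (Metric.ball u δ) := by
  rw [withDensity_apply _ Metric.isOpen_ball.measurableSet, ← setLIntegral_const]
  exact setLIntegral_mono' Metric.isOpen_ball.measurableSet fun x hx =>
    ENNReal.ofReal_le_ofReal (Real.exp_le_exp.2 (neg_le_neg (h x hx)))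

lemma withDensity_exp_neg_ball_le_mean {u : X} {δ c : ℝ} (h : ∀ x ∈ Metric.ball u δ, c ≤ Ψ x)
    (v : X) :
    μ.withDensity (fun x => ENNReal.ofReal (Real.exp (-Ψ x))) (Metric.ball u δ) ≤
      ENNReal.ofReal (Real.exp
        (-c - (⟪v, u - ∫ u, u ∂μ⟫ - covarianceBilin μ v v / 2) + δ * ‖v‖)) *
        μ (Metric.ball (∫ u, u ∂μ) δ) := by
  refine (withDensity_exp_neg_ball_le h).trans
    ((mul_le_mul_right (measure_ball_le_exp_mul_mean μ v u δ) _).trans_eq ?_)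
  rw [← mul_assoc, ← ENNReal.ofReal_mul (Real.exp_pos _).le, ← Real.exp_add]
  congr 3
  ring

/-- For fixed v the exponent is jointly continuous in radius and centre. The product filter is what
allows moving centres in the compactness argument. -/
lemma eventually_withDensity_ball_le_of_inner (hΨ : Continuous Ψ) {z v : X} {b : ℝ}
    (hb : b < Ψ z + (⟪v, z - ∫ u, u ∂μ⟫ - covarianceBilin μ v v / 2)) :
    ∀ᶠ p : ℝ × X in 𝓝 0 ×ˢ 𝓝 z,
      μ.withDensity (fun x => ENNReal.ofReal (Real.exp (-Ψ x))) (Metric.ball p.2 p.1) ≤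
        ENNReal.ofReal (Real.exp (-b)) * μ (Metric.ball (∫ u, u ∂μ) p.1) := by
  obtain ⟨c, hc, hcz⟩ : ∃ c, c < Ψ z ∧
      b < c + (⟪v, z - ∫ u, u ∂μ⟫ - covarianceBilin μ v v / 2) :=
    ⟨Ψ z - (Ψ z + (⟪v, z - ∫ u, u ∂μ⟫ - covarianceBilin μ v v / 2) - b) / 2, by linarith,
      by linarith⟩
  obtain ⟨ρ, hρ, hball⟩ := Metric.eventually_nhds_iff.1
    (hΨ.continuousAt.eventually (lt_mem_nhds hc))
  rw [← nhds_prod_eq]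
  have h1 : ∀ᶠ p : ℝ × X in 𝓝 (0, z), p.1 + dist p.2 z < ρ :=
    (Continuous.tendsto (by fun_prop) ((0 : ℝ), z)).eventually (gt_mem_nhds (by simpa using hρ))
  have h2 : ∀ᶠ p : ℝ × X in 𝓝 (0, z),
      -c - (⟪v, p.2 - ∫ u, u ∂μ⟫ - covarianceBilin μ v v / 2) + p.1 * ‖v‖ < -b :=
    (Continuous.tendsto (by fun_prop) ((0 : ℝ), z)).eventually (gt_mem_nhds (by
      simp only [zero_mul]; linarith))
  filter_upwards [h1, h2] with p hp1 hp2
  refine (withDensity_exp_neg_ball_le_mean (c := c) (fun x hx => ?_) v).trans ?_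
  · refine (hball ?_).le
    linarith [dist_triangle x p.2 z, Metric.mem_ball.1 hx]
  · exact mul_le_mul_left (ENNReal.ofReal_le_ofReal (Real.exp_le_exp.2 hp2.le)) _

/-- Some single v already witnesses an energy above b: otherwise duality would put z in the shifted
Cameron-Martin space with energy at most b. Off that space b is arbitrary. -/
lemma eventually_withDensity_ball_le (hΨ : Continuous Ψ) {z : X} {b : ℝ}
    (hb : z - ∫ u, u ∂μ ∈ cameronMartinSpace μ →
      b < Ψ z + 1 / 2 * (cameronMartinNorm μ (z - ∫ u, u ∂μ)).toReal ^ 2) :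
    ∀ᶠ p : ℝ × X in 𝓝 0 ×ˢ 𝓝 z,
      μ.withDensity (fun x => ENNReal.ofReal (Real.exp (-Ψ x))) (Metric.ball p.2 p.1) ≤
        ENNReal.ofReal (Real.exp (-b)) * μ (Metric.ball (∫ u, u ∂μ) p.1) := by
  by_cases H : ∀ v, ⟪v, z - ∫ u, u ∂μ⟫ - covarianceBilin μ v v / 2 ≤ b - Ψ z
  · have := mem_cameronMartinSpace_of_forall_inner_le H
    linarith [hb this.1]
  · push Not at H
    obtain ⟨v, hv⟩ := H
    exact eventually_withDensity_ball_le_of_inner hΨ (v := v) (by linarith)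

lemma eventually_le_withDensity_ball (hΨ : Continuous Ψ) {z : X} {b : ℝ}
    (hz : z - ∫ u, u ∂μ ∈ cameronMartinSpace μ)
    (hb : Ψ z + 1 / 2 * (cameronMartinNorm μ (z - ∫ u, u ∂μ)).toReal ^ 2 < b) :
    ∀ᶠ r : ℝ in 𝓝 0, ENNReal.ofReal (Real.exp (-b)) * μ (Metric.ball (∫ u, u ∂μ) r) ≤
      μ.withDensity (fun x => ENNReal.ofReal (Real.exp (-Ψ x))) (Metric.ball z r) := by
  set N := 1 / 2 * (cameronMartinNorm μ (z - ∫ u, u ∂μ)).toReal ^ 2 with hN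
  obtain ⟨ρ, hρ, hball⟩ := Metric.eventually_nhds_iff.1
    (hΨ.continuousAt.eventually (gt_mem_nhds (show Ψ z < b - N by linarith)))
  filter_upwards [gt_mem_nhds hρ] with r hr
  refine le_trans ?_ (le_withDensity_exp_neg_ball (c := b - N) fun x hx =>
    (hball ((Metric.mem_ball.1 hx).trans hr)).le)
  refine le_trans (le_of_eq ?_) (mul_le_mul_right (exp_mul_measure_ball_mean_le μ hz r) _)
  rw [← mul_assoc, ← ENNReal.ofReal_mul (Real.exp_pos _).le, ← Real.exp_add, ← hN]
  congr 4
  ring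

/-- The uniform small-ball upper bound for a tilted Gaussian measure. -/
lemma eventually_forall_withDensity_ball_le (hΨ : Continuous Ψ) {M a b : ℝ} (hM : ∀ u, M ≤ Ψ u)
    (ha : ∀ u, u - ∫ u, u ∂μ ∈ cameronMartinSpace μ →
      a ≤ Ψ u + 1 / 2 * (cameronMartinNorm μ (u - ∫ u, u ∂μ)).toReal ^ 2) (hb : b < a) :
    ∀ᶠ r : ℝ in 𝓝[>] 0, ∀ u,
      μ.withDensity (fun x => ENNReal.ofReal (Real.exp (-Ψ x))) (Metric.ball u r) ≤
        ENNReal.ofReal (Real.exp (-b)) * μ (Metric.ball (∫ u, u ∂μ) r) := by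
  -- Failure supplies radii δ n tending to zero and centres u n violating the bound. Comparing with
  -- the upper bound for each v, with M in place of the potential, gives the dual inequality needed
  -- for compactness with R = b - M.
  by_contra hcon
  obtain ⟨δ, hδ, hu⟩ := exists_seq_forall_of_frequently
    ((not_eventually.1 hcon).and_eventually self_mem_nhdsWithin)
  have hδ0 : Tendsto δ atTop (𝓝 0) := hδ.mono_right nhdsWithin_le_nhds
  have hpos : ∀ n, 0 < δ n := fun n => (hu n).2
  have hu' := fun n => not_forall.1 (hu n).1
  choose u hu using hu'
  obtain ⟨z, φ, hφ, hz⟩ := exists_tendsto_subseq_of_inner_sub_mean_le (μ := μ) (u := u) (δ := δ)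
    (R := b - M) (fun n => (hpos n).le) hδ0 fun n v => by
      by_contra! hlt
      refine hu n ((withDensity_exp_neg_ball_le_mean (c := M) (fun x _ => hM x) v).trans ?_)
      refine mul_le_mul_left (ENNReal.ofReal_le_ofReal (Real.exp_le_exp.2 ?_)) _
      linarith
  have hev := eventually_withDensity_ball_le (μ := μ) hΨ (z := z) (b := b)
    fun hzE => hb.trans_le (ha z hzE)
  obtain ⟨n, hn⟩ := (((hδ0.comp hφ.tendsto_atTop).prodMk hz).eventually hev).exists
  exact hu (φ n) hn

/-- The ratio never exceeds one. For small radii the lower bound at z and the uniform upper bound,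
each with error ε in the exponent, force it above exp(-2ε). -/
lemma isMAPEstimator_withDensity_of_forall_le (hΨ : Continuous Ψ) {M : ℝ} (hM : ∀ u, M ≤ Ψ u)
    {z : X} (hz : z - ∫ u, u ∂μ ∈ cameronMartinSpace μ)
    (ha : ∀ u, u - ∫ u, u ∂μ ∈ cameronMartinSpace μ →
      Ψ z + 1 / 2 * (cameronMartinNorm μ (z - ∫ u, u ∂μ)).toReal ^ 2 ≤
        Ψ u + 1 / 2 * (cameronMartinNorm μ (u - ∫ u, u ∂μ)).toReal ^ 2) :
    IsMAPEstimator (μ.withDensity fun x => ENNReal.ofReal (Real.exp (-Ψ x))) z := by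
  set a := Ψ z + 1 / 2 * (cameronMartinNorm μ (z - ∫ u, u ∂μ)).toReal ^ 2 with haz
  refine tendsto_order.2 ⟨fun t ht => ?_, fun t ht => Eventually.of_forall fun r =>
    lt_of_le_of_lt (ENNReal.div_le_of_le_mul ?_) ht⟩
  · have hcont : Tendsto (fun ε : ℝ => ENNReal.ofReal (Real.exp (-(2 * ε)))) (𝓝[>] 0) (𝓝 1) := by
      have : Tendsto (fun ε : ℝ => ENNReal.ofReal (Real.exp (-(2 * ε)))) (𝓝 0)
          (𝓝 (ENNReal.ofReal (Real.exp (-(2 * 0))))) :=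
        (ENNReal.continuous_ofReal.comp (by fun_prop)).tendsto 0
      simp only [mul_zero, neg_zero, Real.exp_zero, ENNReal.ofReal_one] at this
      exact this.mono_left nhdsWithin_le_nhds
    obtain ⟨ε, hεt, hε⟩ := ((hcont.eventually (lt_mem_nhds ht)).and self_mem_nhdsWithin).exists
    have hε : 0 < ε := hε
    filter_upwards [eventually_forall_withDensity_ball_le hΨ hM ha (show a - ε < a by linarith),
      (eventually_le_withDensity_ball hΨ hz (show _ < a + ε by linarith)).filter_mono
        nhdsWithin_le_nhds, self_mem_nhdsWithin] with r h1 h2 hr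
    have hg0 := (measure_ball_mean_pos μ hr).ne'
    have hgt : μ (Metric.ball (∫ u, u ∂μ) r) ≠ ∞ := measure_ne_top _ _
    refine hεt.trans_le (le_trans ?_ (ENNReal.div_le_div h2 (iSup_le h1)))
    rw [ENNReal.mul_div_mul_right _ _ hg0 hgt, ← ENNReal.ofReal_div_of_pos (Real.exp_pos _),
      ← Real.exp_sub]
    refine ENNReal.ofReal_le_ofReal (Real.exp_le_exp.2 ?_)
    linarith
  · rw [one_mul]
    exact le_iSup (fun x => μ.withDensity (fun x => ENNReal.ofReal (Real.exp (-Ψ x)))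
      (Metric.ball x r)) z

/-- If w had smaller energy, or z lay off the shifted Cameron-Martin space, levels b₁ < b₂ would
separate them, and the ratio at z would stay below exp(b₁ - b₂) < 1. -/
lemma le_of_isMAPEstimator_withDensity (hΨ : Continuous Ψ) {z : X}
    (hMAP : IsMAPEstimator (μ.withDensity fun x => ENNReal.ofReal (Real.exp (-Ψ x))) z)
    {w : X} (hw : w - ∫ u, u ∂μ ∈ cameronMartinSpace μ) :
    z - ∫ u, u ∂μ ∈ cameronMartinSpace μ ∧
      Ψ z + 1 / 2 * (cameronMartinNorm μ (z - ∫ u, u ∂μ)).toReal ^ 2 ≤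
        Ψ w + 1 / 2 * (cameronMartinNorm μ (w - ∫ u, u ∂μ)).toReal ^ 2 := by
  by_contra hcon
  obtain ⟨b₁, b₂, h1, h12, h2⟩ : ∃ b₁ b₂ : ℝ,
      Ψ w + 1 / 2 * (cameronMartinNorm μ (w - ∫ u, u ∂μ)).toReal ^ 2 < b₁ ∧ b₁ < b₂ ∧
      (z - ∫ u, u ∂μ ∈ cameronMartinSpace μ →
        b₂ < Ψ z + 1 / 2 * (cameronMartinNorm μ (z - ∫ u, u ∂μ)).toReal ^ 2) := by
    by_cases hz : z - ∫ u, u ∂μ ∈ cameronMartinSpace μ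
    · obtain ⟨c, h1, h2⟩ := exists_between (not_le.1 fun h => hcon ⟨hz, h⟩)
      obtain ⟨d, h3, h4⟩ := exists_between h2
      exact ⟨c, d, h1, h3, fun _ => h4⟩
    · exact ⟨_, _, lt_add_one _, lt_add_one _, fun h => absurd h hz⟩
  have hup : ∀ᶠ r : ℝ in 𝓝 0, μ.withDensity (fun x => ENNReal.ofReal (Real.exp (-Ψ x)))
      (Metric.ball z r) ≤ ENNReal.ofReal (Real.exp (-b₂)) * μ (Metric.ball (∫ u, u ∂μ) r) :=
    (tendsto_id.prodMk tendsto_const_nhds).eventually (eventually_withDensity_ball_le hΨ h2)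
  have hle : (1 : ℝ≥0∞) ≤ ENNReal.ofReal (Real.exp (-b₂ - -b₁)) := by
    refine le_of_tendsto hMAP ?_
    filter_upwards [hup.filter_mono nhdsWithin_le_nhds,
      (eventually_le_withDensity_ball hΨ hw h1).filter_mono nhdsWithin_le_nhds,
      self_mem_nhdsWithin] with r h3 h4 hr
    have hg0 := (measure_ball_mean_pos μ hr).ne'
    have hgt : μ (Metric.ball (∫ u, u ∂μ) r) ≠ ∞ := measure_ne_top _ _
    refine (ENNReal.div_le_div h3 (h4.trans (le_iSup (fun x => μ.withDensity
      (fun x => ENNReal.ofReal (Real.exp (-Ψ x))) (Metric.ball x r)) w))).trans ?_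
    rw [ENNReal.mul_div_mul_right _ _ hg0 hgt, ← ENNReal.ofReal_div_of_pos (Real.exp_pos _),
      ← Real.exp_sub]
  rw [ENNReal.one_le_ofReal, Real.one_le_exp_iff] at hle
  linarith

end Tilted

/-! ### The posterior as a tilt, with log Z absorbed into the potential -/

lemma posterior_eq_withDensity_exp_neg {X : Type*} [MeasurableSpace X] {μ : Measure X} {Φ : X → ℝ}
    (hZ : 0 < ∫ u, Real.exp (-Φ u) ∂μ) :
    posterior μ Φ = μ.withDensity fun x =>
      ENNReal.ofReal (Real.exp (-(Φ x + Real.log (∫ u, Real.exp (-Φ u) ∂μ)))) := by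
  simp_rw [posterior, neg_add, Real.exp_add, Real.exp_neg (Real.log _), Real.exp_log hZ,
    div_eq_mul_inv]

section Posterior

variable {X : Type*} [NormedAddCommGroup X] [InnerProductSpace ℝ X] [MeasurableSpace X]
  {μ : Measure X} {Φ : X → ℝ}

variable [BorelSpace X]

omit [InnerProductSpace ℝ X] in
lemma integral_exp_neg_pos [IsProbabilityMeasure μ] (hΦ : Continuous Φ) {M : ℝ}
    (hM : ∀ u, M ≤ Φ u) : 0 < ∫ u, Real.exp (-Φ u) ∂μ := by
  refine integral_exp_pos (Integrable.of_bound (C := Real.exp (-M)) ?_ (ae_of_all _ fun u => ?_))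
  · exact Continuous.aestronglyMeasurable (by fun_prop)
  · rw [Real.norm_of_nonneg (Real.exp_pos _).le]
    exact Real.exp_le_exp.2 (neg_le_neg (hM u))

lemma onsagerMachlup_of_mem {z : X} (hz : z - ∫ u, u ∂μ ∈ cameronMartinSpace μ) :
    onsagerMachlup μ Φ z =
      ((Φ z + 1 / 2 * (cameronMartinNorm μ (z - ∫ u, u ∂μ)).toReal ^ 2 : ℝ) : EReal) :=
  if_pos hz

lemma onsagerMachlup_of_notMem {z : X} (hz : z - ∫ u, u ∂μ ∉ cameronMartinSpace μ) :
    onsagerMachlup μ Φ z = ⊤ :=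
  if_neg hz

lemma mean_sub_mean_mem : (∫ u, u ∂μ) - ∫ u, u ∂μ ∈ cameronMartinSpace μ := by
  simp [cameronMartinSpace, cameronMartinNorm]

variable [CompleteSpace X] [SecondCountableTopology X] [IsGaussian μ]

theorem onsagerMachlup_le_of_isMAPEstimator (hΦ : Continuous Φ) {M : ℝ} (hM : ∀ u, M ≤ Φ u)
    {z : X} (hz : IsMAPEstimator (posterior μ Φ) z) (u : X) :
    onsagerMachlup μ Φ z ≤ onsagerMachlup μ Φ u := by
  by_cases hu : u - ∫ u, u ∂μ ∈ cameronMartinSpace μ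
  · rw [posterior_eq_withDensity_exp_neg (integral_exp_neg_pos hΦ hM)] at hz
    obtain ⟨hzE, hle⟩ := le_of_isMAPEstimator_withDensity (by fun_prop) hz hu
    rw [onsagerMachlup_of_mem hzE, onsagerMachlup_of_mem hu, EReal.coe_le_coe_iff]
    linarith
  · rw [onsagerMachlup_of_notMem hu]
    exact le_top

theorem isMAPEstimator_of_onsagerMachlup_le (hΦ : Continuous Φ) {M : ℝ} (hM : ∀ u, M ≤ Φ u)
    {z : X} (hz : ∀ u, onsagerMachlup μ Φ z ≤ onsagerMachlup μ Φ u) :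
    z - ∫ u, u ∂μ ∈ cameronMartinSpace μ ∧ IsMAPEstimator (posterior μ Φ) z := by
  have hzE : z - ∫ u, u ∂μ ∈ cameronMartinSpace μ := by
    by_contra hzE
    have := hz (∫ u, u ∂μ)
    rw [onsagerMachlup_of_notMem hzE, onsagerMachlup_of_mem mean_sub_mean_mem] at this
    exact absurd this (not_le.2 (EReal.coe_lt_top _))
  refine ⟨hzE, ?_⟩
  rw [posterior_eq_withDensity_exp_neg (integral_exp_neg_pos hΦ hM)]
  refine isMAPEstimator_withDensity_of_forall_le (by fun_prop)
    (M := M + Real.log (∫ u, Real.exp (-Φ u) ∂μ)) (fun u => by linarith [hM u]) hzE fun u hu => ?_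
  have := hz u
  rw [onsagerMachlup_of_mem hzE, onsagerMachlup_of_mem hu, EReal.coe_le_coe_iff] at this
  linarith

end Posterior

/-! ### Bayes' formula -/

section Bayes

/-- **Bayes' formula**: if `(x, y)` has a positive density with respect to a product measure, then
the conditional law of `x` given `y` has the normalized density. -/
lemma condDistrib_ae_eq_withDensity_div {X Y Ω : Type*} [MeasurableSpace X] [StandardBorelSpace X]
    [Nonempty X] [MeasurableSpace Y] [MeasurableSpace Ω] {P : Measure Ω} [IsProbabilityMeasure P]
    {x : Ω → X} {y : Ω → Y} (hx : Measurable x) (hy : Measurable y) {μ : Measure X}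
    [IsProbabilityMeasure μ] {Q : Measure Y} [SFinite Q] {f : X × Y → ℝ≥0∞} (hf : Measurable f)
    (hf0 : ∀ p, f p ≠ 0) (h : P.map (fun ω => (x ω, y ω)) = (μ.prod Q).withDensity f) :
    ∀ᵐ v ∂(P.map y), ∫⁻ w, f (w, v) ∂μ ≠ ∞ ∧ condDistrib x y P v =
      μ.withDensity (fun u => f (u, v) / ∫⁻ w, f (w, v) ∂μ) := by
  set F : Y → ℝ≥0∞ := fun v => ∫⁻ w, f (w, v) ∂μ with hF
  have hFm : Measurable F := hf.lintegral_prod_left'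
  have hF0 : ∀ v, F v ≠ 0 := fun v h0 => by
    rw [hF, lintegral_eq_zero_iff (by fun_prop)] at h0
    obtain ⟨u, hu⟩ := h0.exists
    exact hf0 _ hu
  have hswap : P.map (fun ω => (y ω, x ω)) = (Q.prod μ).withDensity (fun p => f p.swap) := by
    have e : (fun ω => (y ω, x ω)) = Prod.swap ∘ fun ω => (x ω, y ω) := rfl
    rw [e, ← Measure.map_map measurable_swap (by fun_prop), h]
    ext s hs
    rw [Measure.map_apply measurable_swap hs, withDensity_apply _ (measurable_swap hs),
      withDensity_apply _ hs, ← Measure.prod_swap, setLIntegral_map (measurable_swap hs) hf measurable_swap]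
    rfl
  have hslice : ∀ s : Set (Y × X), MeasurableSet s → P.map (fun ω => (y ω, x ω)) s =
      ∫⁻ v, ∫⁻ u in Prod.mk v ⁻¹' s, f (u, v) ∂μ ∂Q := fun s hs => by
    rw [hswap, withDensity_apply _ hs, ← lintegral_indicator hs, lintegral_prod _ (by
      exact ((hf.comp measurable_swap).indicator hs).aemeasurable)]
    refine lintegral_congr fun v => ?_
    rw [← lintegral_indicator (measurable_prodMk_left hs)]
    rfl
  have hymap : P.map y = Q.withDensity F := by
    ext s hs
    have e : P.map y s = P.map (fun ω => (y ω, x ω)) (Prod.fst ⁻¹' s) := by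
      rw [Measure.map_apply hy hs, Measure.map_apply (by fun_prop) (measurable_fst hs)]
      rfl
    rw [e, hslice _ (measurable_fst hs), withDensity_apply _ hs, ← lintegral_indicator hs]
    refine lintegral_congr fun v => ?_
    by_cases hv : v ∈ s
    · have : Prod.mk v ⁻¹' (Prod.fst ⁻¹' s : Set (Y × X)) = Set.univ := by ext; simpa using hv
      simp [this, hv, hF]
    · have : Prod.mk v ⁻¹' (Prod.fst ⁻¹' s : Set (Y × X)) = ∅ := by ext; simpa using hv
      simp [this, hv]
  -- F is the density of the law of y, which has finite mass.
  have hFfin : ∀ᵐ v ∂Q, F v < ∞ := by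
    refine ae_lt_top hFm ?_
    rw [← setLIntegral_univ, ← withDensity_apply _ MeasurableSet.univ, ← hymap]
    exact measure_ne_top _ _
  have hkm : Measurable (Function.uncurry fun v u => f (u, v) / F v) :=
    (hf.comp measurable_swap).div (hFm.comp measurable_fst)
  set κ : Kernel Y X := (Kernel.const Y μ).withDensity (fun v u => f (u, v) / F v) with hκ
  have hκa : ∀ v, κ v = μ.withDensity fun u => f (u, v) / F v := fun v => by
    rw [hκ, Kernel.withDensity_apply _ hkm, Kernel.const_apply]
  have hκs : ∀ v s, MeasurableSet s → κ v s = (∫⁻ u in s, f (u, v) ∂μ) / F v := fun v s hs => by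
    rw [hκa, withDensity_apply _ hs]
    simp_rw [div_eq_mul_inv]
    rw [lintegral_mul_const _ (by fun_prop)]
  -- The total mass is F v / F v, at most one even where F v is infinite, so the kernel needs no
  -- modification on that null set.
  have : IsFiniteKernel κ := ⟨1, ENNReal.one_lt_top, fun v => by
    rw [hκs v _ MeasurableSet.univ, setLIntegral_univ]
    exact ENNReal.div_self_le_one⟩
  have hcomp : P.map (fun ω => (y ω, x ω)) = P.map y ⊗ₘ κ := by
    ext s hs
    have hm := Kernel.measurable_kernel_prodMk_left (κ := κ) hs
    rw [hslice s hs, Measure.compProd_apply hs, hymap,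
      lintegral_withDensity_eq_lintegral_mul _ hFm hm]
    refine lintegral_congr_ae ?_
    filter_upwards [hFfin] with v hv
    rw [Pi.mul_apply, hκs v _ (measurable_prodMk_left hs), ENNReal.mul_div_cancel (hF0 v) hv.ne]
  have hac : P.map y ≪ Q := hymap ▸ withDensity_absolutelyContinuous _ _
  filter_upwards [condDistrib_ae_eq_of_measure_eq_compProd y hx.aemeasurable hcomp,
    hac.ae_le hFfin] with v hv hv'
  exact ⟨hv'.ne, by rw [hv, hκa]⟩

lemma continuous_of_lipschitz_on_bounded {X : Type*} [NormedAddCommGroup X] {Φ : X → ℝ}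
    (h : ∀ r : ℝ, 0 < r → ∃ K : ℝ, ∀ u₁ u₂ : X, ‖u₁‖ < r → ‖u₂‖ < r →
      |Φ u₁ - Φ u₂| ≤ K * ‖u₁ - u₂‖) : Continuous Φ := by
  refine continuous_iff_continuousAt.2 fun u => ?_
  obtain ⟨K, hK⟩ := h (‖u‖ + 1) (by positivity)
  refine tendsto_iff_dist_tendsto_zero.2 ?_
  have hlim : Tendsto (fun w => K * ‖w - u‖) (𝓝 u) (𝓝 0) := by
    have : Tendsto (fun w => K * ‖w - u‖) (𝓝 u) (𝓝 (K * ‖u - u‖)) :=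
      Continuous.tendsto (by fun_prop) u
    simpa using this
  refine squeeze_zero' (Eventually.of_forall fun _ => dist_nonneg) ?_ hlim
  have hev : ∀ᶠ w in 𝓝 u, ‖w‖ < ‖u‖ + 1 := continuous_norm.continuousAt.eventually
    (gt_mem_nhds (lt_add_one _))
  filter_upwards [hev] with w hw
  exact hK w u hw (lt_add_one _)

/-- A joint law is the density times a product measure if the conditional laws have densities. -/
lemma map_prodMk_eq_withDensity_of_condDistrib {X Y Ω : Type*} [MeasurableSpace X]
    [MeasurableSpace Y] [StandardBorelSpace Y] [Nonempty Y] [MeasurableSpace Ω] {P : Measure Ω}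
    [IsFiniteMeasure P] {x : Ω → X} {y : Ω → Y} (hy : Measurable y) {Q : Measure Y} [SFinite Q]
    {f : X × Y → ℝ≥0∞} (hf : Measurable f)
    (h : ∀ᵐ u ∂(P.map x), condDistrib y x P u = Q.withDensity fun v => f (u, v)) :
    P.map (fun ω => (x ω, y ω)) = ((P.map x).prod Q).withDensity f := by
  rw [← compProd_map_condDistrib hy.aemeasurable]
  ext s hs
  rw [Measure.compProd_apply hs, withDensity_apply _ hs, ← lintegral_indicator hs,
    lintegral_prod _ (hf.indicator hs).aemeasurable]
  refine lintegral_congr_ae ?_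
  filter_upwards [h] with u hu
  rw [hu, withDensity_apply _ (measurable_prodMk_left hs),
    ← lintegral_indicator (measurable_prodMk_left hs)]
  rfl

/-- **Bayes' formula** for densities of the form `exp (-Φ u v) / Z₀ v`. -/
theorem condDistrib_ae_eq_posterior {X Y Ω : Type*} [NormedAddCommGroup X] [InnerProductSpace ℝ X]
    [MeasurableSpace X] [StandardBorelSpace X] [MeasurableSpace Y] [StandardBorelSpace Y]
    [Nonempty Y] [MeasurableSpace Ω] {P : Measure Ω} [IsProbabilityMeasure P]
    {x : Ω → X} {y : Ω → Y} (hx : Measurable x) (hy : Measurable y) {Q : Measure Y} [SigmaFinite Q]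
    {Φ : X → Y → ℝ} {Z₀ : Y → ℝ}
    (hΦm : AEMeasurable (fun p : X × Y => Φ p.1 p.2) ((P.map x).prod Q))
    (hZ₀m : Measurable Z₀) (hZ₀ : ∀ v, 0 < Z₀ v)
    (hac : ∀ᵐ u ∂(P.map x), condDistrib y x P u ≪ Q)
    (hdens : ∀ᵐ u ∂(P.map x), (condDistrib y x P u).rnDeriv Q =ᵐ[Q]
      fun v => ENNReal.ofReal (Real.exp (-Φ u v) / Z₀ v)) :
    ∀ᵐ v ∂(P.map y), condDistrib x y P v = posterior (P.map x) fun u => Φ u v := by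
  have : IsProbabilityMeasure (P.map x) := Measure.isProbabilityMeasure_map hx.aemeasurable
  -- Φ is only almost everywhere measurable; the work is done with a measurable version, and Fubini
  -- recovers Φ on almost every slice in either variable.
  obtain ⟨Φ', hΦ'm, hΦ'⟩ := hΦm
  set f : X × Y → ℝ≥0∞ := fun p => ENNReal.ofReal (Real.exp (-Φ' p) / Z₀ p.2) with hf
  have hfm : Measurable f := by fun_prop
  have hf0 : ∀ p, f p ≠ 0 := fun p =>
    (ENNReal.ofReal_pos.2 (div_pos (Real.exp_pos _) (hZ₀ p.2))).ne'
  have hjoint := map_prodMk_eq_withDensity_of_condDistrib (P := P) (x := x) hy hfm (Q := Q) (by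
    filter_upwards [hac, hdens, Measure.ae_ae_of_ae_prod hΦ'] with u h1 h2 h3
    rw [← Measure.withDensity_rnDeriv_eq _ _ h1]
    refine withDensity_congr_ae ?_
    filter_upwards [h2, h3] with v h4 h5
    rw [h4, hf]
    simp only
    rw [← h5])
  have hswap : ∀ᵐ v ∂Q, ∀ᵐ u ∂(P.map x), Φ u v = Φ' (u, v) := by
    refine Measure.ae_ae_of_ae_prod (p := fun q : Y × X => Φ q.2 q.1 = Φ' (q.2, q.1)) ?_
    rw [← Measure.prod_swap] at hΦ'
    exact ae_of_ae_map measurable_swap.aemeasurable hΦ'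
  have hyac : P.map y ≪ Q := by
    have e : P.map y = (P.map fun ω => (x ω, y ω)).map Prod.snd := by
      rw [Measure.map_map measurable_snd (by fun_prop)]
      rfl
    rw [e, hjoint]
    exact ((withDensity_absolutelyContinuous _ _).map measurable_snd).trans
      Measure.quasiMeasurePreserving_snd.absolutelyContinuous
  filter_upwards [condDistrib_ae_eq_withDensity_div hx hy hfm hf0 hjoint,
    hyac.ae_le hswap] with v hv hsw
  obtain ⟨hfin, hv⟩ := hv
  rw [hv, posterior]
  refine withDensity_congr_ae ?_
  have hZe : ∀ u, f (u, v) = ENNReal.ofReal (Real.exp (-Φ' (u, v))) * ENNReal.ofReal (Z₀ v)⁻¹ :=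
    fun u => by rw [← ENNReal.ofReal_mul (Real.exp_pos _).le, ← div_eq_mul_inv]
  have hc0 : ENNReal.ofReal (Z₀ v)⁻¹ ≠ 0 := (ENNReal.ofReal_pos.2 (inv_pos.2 (hZ₀ v))).ne'
  have hmeas : Measurable fun u => Real.exp (-Φ' (u, v)) := by fun_prop
  have hL : ∫⁻ w, f (w, v) ∂(P.map x) =
      (∫⁻ w, ENNReal.ofReal (Real.exp (-Φ' (w, v))) ∂(P.map x)) * ENNReal.ofReal (Z₀ v)⁻¹ := by
    simp_rw [hZe]
    rw [lintegral_mul_const _ (by fun_prop)]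
  have hLfin : ∫⁻ w, ENNReal.ofReal (Real.exp (-Φ' (w, v))) ∂(P.map x) ≠ ∞ := fun htop => by
    rw [hL, htop, ENNReal.top_mul hc0] at hfin
    exact hfin rfl
  have hint : Integrable (fun u => Real.exp (-Φ' (u, v))) (P.map x) :=
    ⟨hmeas.aestronglyMeasurable, by
      rw [hasFiniteIntegral_iff_ofReal (ae_of_all _ fun _ => (Real.exp_pos _).le)]
      exact lt_top_iff_ne_top.2 hLfin⟩
  have hZ : ∫ u, Real.exp (-Φ u v) ∂(P.map x) = ∫ u, Real.exp (-Φ' (u, v)) ∂(P.map x) :=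
    integral_congr_ae (by filter_upwards [hsw] with u hu; rw [hu])
  filter_upwards [hsw] with u hu
  -- The factor 1/Z₀ v does not depend on u and cancels against the normalisation.
  rw [hL, hZe, ENNReal.mul_div_mul_right _ _ hc0 ENNReal.ofReal_ne_top,
    ← ofReal_integral_eq_lintegral_ofReal hint (ae_of_all _ fun _ => (Real.exp_pos _).le), hu, hZ,
    ENNReal.ofReal_div_of_pos (integral_exp_pos hint)]

end Bayes
end BayesMAP

theorem mainTheorem12
    {X : Type*} [NormedAddCommGroup X] [InnerProductSpace ℝ X] [CompleteSpace X]
    [SecondCountableTopology X] [MeasurableSpace X] [BorelSpace X]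
    {J : ℕ}
    {Ω : Type*} [MeasurableSpace Ω] (P : Measure Ω) [IsProbabilityMeasure P]
    -- the unknown `x`, the model reduction error `ε`, the noise `η`, the forward map `G`
    (x : Ω → X) (ε η : Ω → EuclideanSpace ℝ (Fin J)) (G : X → EuclideanSpace ℝ (Fin J))
    (hxm : Measurable x) (hεm : Measurable ε) (hηm : Measurable η) (hGm : Measurable G)
    -- `(ε, x)` is jointly Gaussian, so that the prior `μ₀ = P.map x` and the law of `ε` are Gaussian
    (hεx : IsGaussian (P.map fun ω => (ε ω, x ω)))
    -- the noise is centred Gaussian and independent of `x` and of `ε`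
    (hη : IsGaussian (P.map η)) (hη0 : ∫ ω, η ω ∂P = 0)
    (hηx : IndepFun η x P) (hηε : IndepFun η ε P)
    -- the data
    (y : Ω → EuclideanSpace ℝ (Fin J)) (hy : ∀ ω, y ω = G (x ω) + ε ω + η ω)
    -- the potential: for almost every `u` the conditional law of `y` given `x = u` has the density
    -- `exp (-Φ(u; v)) / Z₀ v` with respect to the law of the noise
    (Φ : X → EuclideanSpace ℝ (Fin J) → ℝ) (Z₀ : EuclideanSpace ℝ (Fin J) → ℝ)
    (hΦm : AEMeasurable (fun p : X × EuclideanSpace ℝ (Fin J) => Φ p.1 p.2)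
      ((P.map x).prod (P.map η)))
    (hZ₀m : Measurable Z₀) (hZ₀ : ∀ v, 0 < Z₀ v)
    (hac : ∀ᵐ u ∂(P.map x), condDistrib y x P u ≪ P.map η)
    (hdens : ∀ᵐ u ∂(P.map x), (condDistrib y x P u).rnDeriv (P.map η) =ᵐ[P.map η]
      fun v => ENNReal.ofReal (Real.exp (-Φ u v) / Z₀ v))
    -- the potential is Lipschitz in its first argument on bounded sets
    (hΦL : ∀ r : ℝ, 0 < r → ∃ K : ℝ, 0 < K ∧ ∀ (u₁ u₂ : X) (v : EuclideanSpace ℝ (Fin J)),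
      ‖u₁‖ < r → ‖u₂‖ < r → ‖v‖ < r → |Φ u₁ v - Φ u₂ v| ≤ K * ‖u₁ - u₂‖) :
    -- the conditional law of `x` given `y = v` is the posterior measure with potential `Φ(·; v)`
    (∀ᵐ v ∂(P.map y), condDistrib x y P v = BayesMAP.posterior (P.map x) fun u => Φ u v) ∧
    -- for data `v` with `Φ(·; v)` bounded below: MAP estimators are minimisers, and conversely
    ∀ v : EuclideanSpace ℝ (Fin J), (∃ M : ℝ, ∀ u, M ≤ Φ u v) →
      (∀ z, BayesMAP.IsMAPEstimator (BayesMAP.posterior (P.map x) fun u => Φ u v) z →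
        ∀ u, BayesMAP.onsagerMachlup (P.map x) (fun w => Φ w v) z ≤
          BayesMAP.onsagerMachlup (P.map x) (fun w => Φ w v) u) ∧
      (∀ z, (∀ u, BayesMAP.onsagerMachlup (P.map x) (fun w => Φ w v) z ≤
          BayesMAP.onsagerMachlup (P.map x) (fun w => Φ w v) u) →
        z - ∫ u, u ∂(P.map x) ∈ BayesMAP.cameronMartinSpace (P.map x) ∧
        BayesMAP.IsMAPEstimator (BayesMAP.posterior (P.map x) fun u => Φ u v) z) := by
  have hx : IsGaussian (P.map x) := by
    have e : P.map x = (P.map fun ω => (ε ω, x ω)).map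
        (ContinuousLinearMap.snd ℝ (EuclideanSpace ℝ (Fin J)) X) := by
      rw [Measure.map_map (by fun_prop) (by fun_prop)]
      rfl
    rw [e]
    infer_instance
  have hym : Measurable y := by
    rw [funext hy]
    fun_prop
  refine ⟨BayesMAP.condDistrib_ae_eq_posterior hxm hym hΦm hZ₀m hZ₀ hac hdens, fun v ⟨M, hM⟩ => ?_⟩
  have hcont : Continuous fun u => Φ u v :=
    BayesMAP.continuous_of_lipschitz_on_bounded fun r hr => by
      -- The Lipschitz hypothesis also restricts the data, so the radius is enlarged beyond ‖v‖.
      obtain ⟨K, -, hK⟩ := hΦL (max r (‖v‖ + 1)) (lt_max_of_lt_left hr)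
      exact ⟨K, fun u₁ u₂ h₁ h₂ => hK u₁ u₂ v (lt_max_of_lt_left h₁) (lt_max_of_lt_left h₂)
        (lt_max_of_lt_right (lt_add_one _))⟩
  exact ⟨fun z hz u => BayesMAP.onsagerMachlup_le_of_isMAPEstimator hcont hM hz u,
    fun z hz => BayesMAP.isMAPEstimator_of_onsagerMachlup_le hcont hM hz⟩
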